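/- Let $\Pi=PSL_2(\mathbb Z)=\langle a,b\mid a^2,b^3\rangle$, where $a,b$ are the classes of $\begin{pmatrix}0&-1\\1&0\end{pmatrix}$ and $\begin{pmatrix}0&-1\\1&1\end{pmatrix}$, and let $S=\{a,b,b^{-1}\}$. For a subgroup $\Xi\le\Pi$ let $f_n$ be the number of elements of $\Xi$ of word length $n$ with respect to $S$, and let $g_n$ be the number of words of length $n$ in $S$ that define an element of $\Xi$ (equivalently, of circuits of length $n$ at the base point of the Schreier graph of $\Xi\backslash\Pi$). Put $$F(t)=\sum_n f_nt^n,\quad G(t)=\sum_n g_nt^n,\quad \alpha=\limsup_n f_n^{1/n},\quad \nu=\limsup_n g_n^{1/n},\quad \phi(t)=\frac{t\sqrt{4+13t^2+8t^4}-t^2}{2(1+t^2)(1+2t^2)} .$$ Write $F\sim G\circ\phi$ if the following holds. The germ of $G(\phi(t))$ at $t=0$ continues analytically along the real interval $[0,1/\alpha)$ to a function $H$, it does not continue analytically along $[0,1/\alpha]$ (so the radius of convergence $1/\alpha$ of $F$ is also the first positive singularity of $G\circ\phi$), and there is a constant $K>0$ such that $1/K<F(t)/H(t)<K$ for all $t<1/\alpha$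 sufficiently close to $1/\alpha$. Moreover, if $\alpha\ge\sqrt[4]2$, then $G$ converges at $\phi(t)$ and $H(t)=G(\phi(t))$ for every $t\in[0,1/\alpha)$. **Theorem.** (i) If $\Xi\le\Pi$ is torsion-free and $\alpha>1$, then $F\sim G\circ\phi$. (ii) More generally, let $X$ be a simplicial complex in which every vertex lies on exactly one filled-in triangle and on exactly one further edge, and let $o$ be a vertex of $X$. Call a circuit in the $1$-skeleton reduced if it contains no edge followed by its inverse and no two successive edges in the same filled-in triangle. Let $f_n$ and $g_n$ be the numbers of reduced circuits and of all circuits of length $n$ at $o$, and define $F,G,\alpha$ from them as above. If $\alpha>1$, then $F\sim G\circ\phi$. **Corollary.** The word growth $\rho$ of $(\Pi,S)$ is $\sqrt2$. Let $\Xi\le\Pi$ be torsion-free. Then $\nu$ is three times the spectral radius $\limsup_n p_n^{1/n}$ of the simple random walk on $\Xi\backslash\Pi$, where $p_n$ is the probability of return to the base coset after $n$ steps. If $\alpha\in[\sqrt\rho,\rho]$, then $$\frac1\nu=\phi\!\left(\frac1\alpha\right),\qquad\text{so}\qquad \nu=\tfrac12\sqrt{8\alpha^{-2}+13+4\alpha^2}+\tfrac12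 .$$ -/

import Mathlib

open Filter Topology

noncomputable section

namespace ModularCogrowth

/-! ### Counting sequences, their series and growth rates -/

/-- The value at `t` of the power series `∑ c n tⁿ`. -/
def series (c : ℕ → ℕ) (t : ℝ) : ℝ := ∑' n, (c n : ℝ) * t ^ n

/-- The exponential growth rate `limsup (c n)^(1/n)`; when it is positive, its inverse is the
radius of convergence of `series c`. -/
def growthRate (c : ℕ → ℕ) : ℝ :=
  limsup (fun n : ℕ => (c n : ℝ) ^ (1 / (n : ℝ))) atTop

/-- The algebraic function `φ`. -/
def phi (t : ℝ) : ℝ :=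
  (t * √(4 + 13 * t ^ 2 + 8 * t ^ 4) - t ^ 2) / (2 * (1 + t ^ 2) * (1 + 2 * t ^ 2))

/-- `ρ` is the first singularity on the positive half-line of the analytic germ `B` at `0`,
and `H` is the analytic continuation of `B` along `[0, ρ)`. -/
structure IsFirstSingularity (B : ℝ → ℝ) (ρ : ℝ) (H : ℝ → ℝ) : Prop where
  pos : 0 < ρ
  analytic : AnalyticOnNhd ℝ H (Set.Ico 0 ρ)
  germ : H =ᶠ[𝓝 0] B
  singular : ¬ ∃ H' : ℝ → ℝ, AnalyticOnNhd ℝ H' (Set.Icc 0 ρ) ∧ H' =ᶠ[𝓝 0] B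

/-- `F(t) ∼ G(φ(t))` for `F = series f` and `G = series g`: the radius of convergence `1/α` of `F`
is the first positive singularity of `G ∘ φ`, and the quotient of `F` and of `G ∘ φ` is bounded
above and below by positive constants as `t → 1/α` from the left. Here `G ∘ φ` is continued
analytically along `[0, 1/α)`; when `α ≥ √(√2)` no continuation is involved, because `G` converges
at every `φ(t)` with `0 ≤ t < 1/α`. -/
def EquivPhi (f g : ℕ → ℕ) : Prop :=
  ∃ H : ℝ → ℝ,
    IsFirstSingularity (fun t => series g (phi t)) (1 / growthRate f) H ∧
    (∃ K : ℝ, 0 < K ∧ ∀ᶠ t in 𝓝[<] (1 / growthRate f),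
      1 / K < series f t / H t ∧ series f t / H t < K) ∧
    (√(√2) ≤ growthRate f → ∀ t ∈ Set.Ico (0 : ℝ) (1 / growthRate f),
      (Summable fun n : ℕ => (g n : ℝ) * phi t ^ n) ∧ H t = series g (phi t))

/-! ### The modular group and its subgroups -/

/-- The modular group `PSL₂(ℤ)`. -/
abbrev Modular : Type := Matrix.ProjectiveSpecialLinearGroup (Fin 2) ℤ

/-- The standard generator of order two, the class of `!![0, -1; 1, 0]`. -/
def genA : Modular := QuotientGroup.mk ModularGroup.S

/-- The standard generator of order three, the class of `!![0, -1; 1, 1]`. -/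
def genB : Modular := QuotientGroup.mk (ModularGroup.S * ModularGroup.T)

/-- The generating set `{a, b, b⁻¹}`, indexed by `Fin 3`. -/
def gen : Fin 3 → Modular := ![genA, genB, genB⁻¹]

/-- The element defined by a word in the letters `a, b, b⁻¹`. -/
def wordEval {n : ℕ} (w : Fin n → Fin 3) : Modular := (List.ofFn fun i => gen (w i)).prod

/-- The minimal length of a word in `a, b, b⁻¹` that defines `γ`. -/
def wordLength (γ : Modular) : ℕ := sInf {n | ∃ w : Fin n → Fin 3, wordEval w = γ}

/-- The number of elements of `Ξ` of word length `n`. -/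
def cogrowthCount (Ξ : Subgroup Modular) (n : ℕ) : ℕ :=
  Nat.card {γ : Modular // γ ∈ Ξ ∧ wordLength γ = n}

/-- The number of words of length `n` in `a, b, b⁻¹` that define an element of `Ξ`; equivalently,
the number of circuits of length `n` at the base point of the Schreier graph. -/
def circuitCount (Ξ : Subgroup Modular) (n : ℕ) : ℕ :=
  Nat.card {w : Fin n → Fin 3 // wordEval w ∈ Ξ}

/-- `hitProb Ξ n x` is the probability that the simple random walk on the right cosets `Ξ\Π`
(moving from `Ξx` to `Ξxs`, each `s ∈ {a, b, b⁻¹}` having probability `1/3`), started at `Ξx`,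
is at the coset `Ξ` after `n` steps. -/
def hitProb (Ξ : Subgroup Modular) : ℕ → Modular → ℝ
  | 0, x => Set.indicator (Ξ : Set Modular) 1 x
  | n + 1, x => (1 / 3) * ∑ i : Fin 3, hitProb Ξ n (x * gen i)

/-- The spectral radius `limsup (p n)^(1/n)` of the simple random walk on `Ξ\Π`, where `p n` is the
probability of return to the base coset after `n` steps. -/
def walkSpectralRadius (Ξ : Subgroup Modular) : ℝ :=
  limsup (fun n : ℕ => hitProb Ξ n 1 ^ (1 / (n : ℝ))) atTop

/-! ### Complexes of triangles and arcs -/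

/-- A simplicial complex in which every vertex lies on exactly one filled-in triangle and on
exactly one further edge. -/
structure TriangleComplex (V : Type*) where
  /-- the 1-skeleton -/
  graph : SimpleGraph V
  /-- the filled-in triangles -/
  triangles : Set (Finset V)
  isClique : ∀ T ∈ triangles, graph.IsNClique 3 T
  triangle_at : ∀ v, ∃! T, T ∈ triangles ∧ v ∈ T
  edge_at : ∀ v, ∃! w, graph.Adj v w ∧ ∀ T ∈ triangles, ¬ (v ∈ T ∧ w ∈ T)

variable {V : Type*}

/-- A walk is reduced if it has no bump (an edge followed by its inverse) and no two successive
edges in the same filled-in triangle. -/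
def TriangleComplex.IsReduced (X : TriangleComplex V) {u v : V} (p : X.graph.Walk u v) : Prop :=
  p.darts.IsChain fun d e =>
    e ≠ d.symm ∧ ¬ ∃ T ∈ X.triangles, d.fst ∈ T ∧ d.snd ∈ T ∧ e.fst ∈ T ∧ e.snd ∈ T

/-- The number of reduced circuits of length `n` at `o`. -/
def TriangleComplex.reducedCount (X : TriangleComplex V) (o : V) (n : ℕ) : ℕ :=
  Nat.card {p : X.graph.Walk o o // p.length = n ∧ X.IsReduced p}

/-- The number of circuits of length `n` at `o` in the 1-skeleton. -/
def TriangleComplex.circuitCount (X : TriangleComplex V) (o : V) (n : ℕ) : ℕ :=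
  Nat.card {p : X.graph.Walk o o // p.length = n}

end ModularCogrowth

end

open Filter Topology

noncomputable section

namespace ModularCogrowth

/-! The universal cover of a complex of triangles and arcs is the Cayley graph of the modular group,
a tree of triangles. There every path between two points visits all vertices of the reduced path
between them, so the Green function at `u` is `1/c` times a product of first-passage series: a
factor `p` for each arc and `q` for each triangle edge of the reduced path. Decomposing by the first
step gives `p = u + 2uqp`, `q = u(1 + q + pq)` and `c = 1 - up - 2uq`; setting `pq = t²` and
eliminating `p` and `q` yields `u = φ(t)`. Arcs and triangle edges alternate along a reduced path,
so with `r = √(p/q)` a path of length `n` contributes `tⁿ` if `n` is even, and `r tⁿ` or `tⁿ/r` if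
it has one surplus arc or triangle edge. Hence, near `0`, `c(t) G(φ(t)) = F₀(t) + r(t) F₁(t) +
F₂(t)/r(t)`, where `F = F₀ + F₁ + F₂`.

The cover itself is not needed. `sumRed_eq` verifies locally that the weighted sum over reduced
paths solves the Green equation. Iterating that equation bounds `c G(φ(t))` by this sum
(`mul_sum_pathCount_le`), with equality where the sum is bounded and `3φ(t) < 1`
(`le_mul_sum_pathCount_add`).

The right-hand side divided by `c` is analytic on `[0, 1/α)`, because `c > 0` on `[0, 1)`
(`greenInv_pos`) and `α > 1`. Its coefficients are positive at `1/α`, which makes it comparable to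
`F`, and a Pringsheim-type theorem (`exists_summable_of_analyticAt`) shows that the singularities of
the three series cannot cancel. Up to `2^(-1/4)` the function `φ` increases (`phi_lt_phi`), so for
`α ≥ 2^(1/4)` no continuation is involved and the singularity of `G` is exactly `φ(1/α)`.

For a subgroup `Ξ` the same argument runs on the Cayley graph, with path ends weighted by the
indicator of `Ξ`; the normal form theorem (`listEval_injOn`, by ping-pong on quadratic forms)
identifies group elements with alternating words. -/

/-! ### Re-expansion of power series -/

/-- The terms of the expansion of `∑ a n (d + x)ⁿ` in powers of `d` and `x`. -/
def shiftTerm (a : ℕ → ℝ) (d x : ℝ) (p : ℕ × ℕ) : ℝ :=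
  a (p.1 + p.2) * ((p.1 + p.2).choose p.1 : ℝ) * d ^ p.1 * x ^ p.2

/-- The coefficients of the expansion of `∑ a n yⁿ` in powers of `y - d`. -/
def shiftCoeff (a : ℕ → ℝ) (d : ℝ) (k : ℕ) : ℝ :=
  ∑' n, a (n + k) * ((n + k).choose n : ℝ) * d ^ n

theorem sum_antidiagonal_shiftTerm (a : ℕ → ℝ) (d x : ℝ) (n : ℕ) :
    ∑ p ∈ Finset.HasAntidiagonal.antidiagonal n, shiftTerm a d x p = a n * (d + x) ^ n := by
  rw [(Commute.all d x).add_pow', Finset.mul_sum]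
  refine Finset.sum_congr rfl fun p hp => ?_
  rw [Finset.HasAntidiagonal.mem_antidiagonal] at hp
  simp only [shiftTerm, hp, nsmul_eq_mul]
  ring

/-- Nonnegative terms may be summed along antidiagonals first, where the binomial theorem collapses
them. The direction from right to left gives absolute convergence in general; the other one is the
core of Pringsheim's theorem. -/
theorem summable_shiftTerm_iff_of_nonneg {a : ℕ → ℝ} (ha : ∀ n, 0 ≤ a n) {d x : ℝ} (hd : 0 ≤ d)
    (hx : 0 ≤ x) :
    Summable (shiftTerm a d x) ↔ Summable fun n => a n * (d + x) ^ n := by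
  have hnn : ∀ p, 0 ≤ shiftTerm a d x p := fun p => by
    have := ha (p.1 + p.2)
    unfold shiftTerm; positivity
  rw [← Finset.HasAntidiagonal.sigmaAntidiagonalEquivProd.summable_iff,
    summable_sigma_of_nonneg (f := shiftTerm a d x ∘ _) fun p => hnn _]
  have : ∀ n, ∑' p : Finset.HasAntidiagonal.antidiagonal n, shiftTerm a d x p = a n * (d + x) ^ n := fun n => by
    rw [← sum_antidiagonal_shiftTerm, ← Finset.tsum_subtype]
  constructor
  · rintro ⟨-, h⟩
    refine h.congr fun n => ?_
    exact this n
  · intro h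
    refine ⟨fun n => (hasSum_fintype _).summable, h.congr fun n => (this n).symm⟩

theorem abs_shiftTerm (a : ℕ → ℝ) (d x : ℝ) (p : ℕ × ℕ) :
    |shiftTerm a d x p| = shiftTerm (fun n => |a n|) |d| |x| p := by
  simp [shiftTerm, abs_mul]

theorem summable_abs_shiftTerm {a : ℕ → ℝ} {d x : ℝ}
    (h : Summable fun n => |a n| * (|d| + |x|) ^ n) :
    Summable fun p => |shiftTerm a d x p| := by
  simp_rw [abs_shiftTerm]
  exact (summable_shiftTerm_iff_of_nonneg (fun n => abs_nonneg _) (abs_nonneg _)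
    (abs_nonneg _)).2 h

theorem tsum_shiftTerm_fiber (a : ℕ → ℝ) (d x : ℝ) (k : ℕ) :
    ∑' n, shiftTerm a d x (n, k) = shiftCoeff a d k * x ^ k := by
  simp only [shiftTerm, shiftCoeff, tsum_mul_right]

/-- Fubini: the absolutely convergent double series is summed once along antidiagonals and once
along the fibres of the second index. -/
theorem hasSum_shiftCoeff {a : ℕ → ℝ} {d x : ℝ}
    (h : Summable fun n => |a n| * (|d| + |x|) ^ n) :
    HasSum (fun k => shiftCoeff a d k * x ^ k) (∑' n, a n * (d + x) ^ n) := by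
  have hs : Summable (shiftTerm a d x) := (summable_abs_shiftTerm h).of_abs
  have h1 : ∑' p, shiftTerm a d x p = ∑' n, a n * (d + x) ^ n := by
    have hσ := Finset.HasAntidiagonal.sigmaAntidiagonalEquivProd.summable_iff.2 hs
    rw [← Finset.HasAntidiagonal.sigmaAntidiagonalEquivProd.tsum_eq]
    refine (Summable.tsum_sigma' (fun n => (hasSum_fintype _).summable) hσ).trans ?_
    refine tsum_congr fun n => ?_
    rw [← sum_antidiagonal_shiftTerm, ← Finset.tsum_subtype]
    rfl
  rw [← h1]
  have h2 : Summable fun p : ℕ × ℕ => shiftTerm a d x p.swap :=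
    (Equiv.prodComm ℕ ℕ).summable_iff.2 hs
  have h3 := h2.hasSum.prod_fiberwise fun k => (h2.prod_factor k).hasSum
  have h4 : ∑' p : ℕ × ℕ, shiftTerm a d x p.swap = ∑' p, shiftTerm a d x p :=
    (Equiv.prodComm ℕ ℕ).tsum_eq _
  rw [h4] at h3
  convert h3 using 2 with k
  exact (tsum_shiftTerm_fiber a d x k).symm

theorem summable_shiftCoeff_fiber {a : ℕ → ℝ} {d x : ℝ} (hx : x ≠ 0)
    (h : Summable fun n => |a n| * (|d| + |x|) ^ n) (k : ℕ) :
    Summable fun n => a (n + k) * ((n + k).choose n : ℝ) * d ^ n := by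
  have h2 : Summable fun p : ℕ × ℕ => shiftTerm a d x p.swap :=
    (Equiv.prodComm ℕ ℕ).summable_iff.2 (summable_abs_shiftTerm h).of_abs
  have h3 := h2.prod_factor k
  exact (summable_mul_right_iff (pow_ne_zero k hx)).1 h3

theorem abs_shiftCoeff_le {a : ℕ → ℝ} {d x : ℝ} (hx : x ≠ 0)
    (h : Summable fun n => |a n| * (|d| + |x|) ^ n) (k : ℕ) :
    |shiftCoeff a d k| ≤ shiftCoeff (fun n => |a n|) |d| k := by
  have hs := summable_shiftCoeff_fiber (a := fun n => |a n|) (d := |d|) hx (by simpa using h) k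
  have he : ∀ n, |a (n + k) * ((n + k).choose n : ℝ) * d ^ n|
      = |a (n + k)| * ((n + k).choose n : ℝ) * |d| ^ n := fun n => by simp [abs_mul]
  have hs' : Summable fun n => ‖a (n + k) * ((n + k).choose n : ℝ) * d ^ n‖ := hs.congr fun n =>
    (he n).symm
  exact (norm_tsum_le_tsum_norm hs').trans_eq (tsum_congr he)

theorem hasSum_abs_shiftCoeff_le {a : ℕ → ℝ} {d x : ℝ} (hx : x ≠ 0)
    (h : Summable fun n => |a n| * (|d| + |x|) ^ n) :
    Summable (fun k => |shiftCoeff a d k| * |x| ^ k) ∧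
      ∑' k, |shiftCoeff a d k| * |x| ^ k ≤ ∑' n, |a n| * (|d| + |x|) ^ n := by
  have hs := hasSum_shiftCoeff (a := fun n => |a n|) (d := |d|) (x := |x|) (by simpa using h)
  have hle : ∀ k, |shiftCoeff a d k| * |x| ^ k ≤ shiftCoeff (fun n => |a n|) |d| k * |x| ^ k :=
    fun k => mul_le_mul_of_nonneg_right (abs_shiftCoeff_le hx h k) (by positivity)
  have hS := Summable.of_nonneg_of_le (fun k => by positivity) hle hs.summable
  exact ⟨hS, hs.tsum_eq ▸ hS.tsum_le_tsum hle hs.summable⟩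

theorem shiftCoeff_nonneg {a : ℕ → ℝ} (ha : ∀ n, 0 ≤ a n) {d : ℝ} (hd : 0 ≤ d) (k : ℕ) :
    0 ≤ shiftCoeff a d k :=
  tsum_nonneg fun n => by have := ha (n + k); positivity

/-- A series with nonnegative terms converges at `d + x` as soon as its expansion at `d` converges
at `x`. -/
theorem summable_of_summable_shiftCoeff {a : ℕ → ℝ} (ha : ∀ n, 0 ≤ a n) {d x y : ℝ} (hd : 0 ≤ d)
    (hx : 0 ≤ x) (hy : 0 < y) (h : Summable fun n => a n * (d + y) ^ n)
    (hs : Summable fun k => shiftCoeff a d k * x ^ k) :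
    Summable fun n => a n * (d + x) ^ n := by
  rw [← summable_shiftTerm_iff_of_nonneg ha hd hx, ← (Equiv.prodComm ℕ ℕ).summable_iff,
    summable_prod_of_nonneg]
  · refine ⟨fun k => ?_, hs.congr fun k => (tsum_shiftTerm_fiber a d x k).symm⟩
    have := summable_shiftCoeff_fiber (a := a) (d := d) hy.ne'
      (by simpa [abs_of_nonneg, ha, hd, hy.le] using h) k
    exact this.mul_right (x ^ k)
  · intro p
    have := ha (p.2 + p.1)
    simp only [Function.comp, Equiv.prodComm_apply, shiftTerm, Prod.fst_swap, Prod.snd_swap,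
      Pi.zero_apply]
    positivity

theorem summable_abs_of_bounded {a : ℕ → ℝ} {y x B : ℝ} (hx : 0 ≤ x) (hxy : x < y)
    (h : ∀ n, |a n| * y ^ n ≤ B) : Summable fun n => |a n| * x ^ n := by
  have hy : 0 < y := hx.trans_lt hxy
  have hg := (summable_geometric_of_lt_one (div_nonneg hx hy.le) ((div_lt_one hy).2 hxy)).mul_left B
  refine Summable.of_nonneg_of_le (fun n => by positivity) (fun n => ?_) hg
  have : |a n| * x ^ n = |a n| * y ^ n * (x / y) ^ n := by
    rw [div_pow]; field_simp
  rw [this]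
  exact mul_le_mul_of_nonneg_right (h n) (by positivity)

theorem exists_bound_of_summable {b : ℕ → ℝ} (h : Summable b) : ∃ B, 0 ≤ B ∧ ∀ n, |b n| ≤ B := by
  obtain ⟨B, hB⟩ := (h.tendsto_atTop_zero.abs).bddAbove_range
  exact ⟨max B 0, le_max_right _ _, fun n => (hB ⟨n, rfl⟩).trans (le_max_left _ _)⟩

theorem summable_abs_of_summable {a : ℕ → ℝ} {y x : ℝ} (hx : 0 ≤ x) (hxy : x < y)
    (h : Summable fun n => a n * y ^ n) : Summable fun n => |a n| * x ^ n := by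
  obtain ⟨B, -, hB⟩ := exists_bound_of_summable h
  refine summable_abs_of_bounded hx hxy (B := B) fun n => ?_
  have := hB n
  rwa [abs_mul, abs_pow, abs_of_pos (hx.trans_lt hxy)] at this

/-! ### Power series and analytic functions -/

theorem exists_coeff_of_analyticAt {F : ℝ → ℝ} {z : ℝ} (h : AnalyticAt ℝ F z) :
    ∃ (a : ℕ → ℝ) (δ : ℝ), 0 < δ ∧ (Summable fun n => |a n| * δ ^ n) ∧
      ∀ x, |x| < δ → F (z + x) = ∑' n, a n * x ^ n := by
  obtain ⟨p, hp⟩ := h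
  obtain ⟨ε, hε, H⟩ := Metric.eventually_nhds_iff.1 (hasFPowerSeriesAt_iff.1 hp)
  have H' : ∀ x, |x| < ε → HasSum (fun n => p.coeff n * x ^ n) (F (z + x)) := fun x hx => by
    simpa [mul_comm] using @H x (by simpa using hx)
  -- The expansion holds up to `ε`, so it converges at `ε / 2`, hence absolutely at the smaller
  -- radius `ε / 4`.
  refine ⟨p.coeff, ε / 4, by positivity, ?_, fun x hx => (H' x (by linarith)).tsum_eq.symm⟩
  exact summable_abs_of_summable (by positivity) (by linarith : ε / 4 < ε / 2)
    (H' (ε / 2) (by rw [abs_of_pos] <;> linarith)).summable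

theorem coeff_unique {F : ℝ → ℝ} {z : ℝ} {a b : ℕ → ℝ}
    (ha : ∀ᶠ x in 𝓝 (0 : ℝ), HasSum (fun n => a n * x ^ n) (F (z + x)))
    (hb : ∀ᶠ x in 𝓝 (0 : ℝ), HasSum (fun n => b n * x ^ n) (F (z + x))) : a = b := by
  have key : ∀ c : ℕ → ℝ, (∀ᶠ x in 𝓝 (0 : ℝ), HasSum (fun n => c n * x ^ n) (F (z + x))) →
      HasFPowerSeriesAt F (FormalMultilinearSeries.ofScalars ℝ c) z := fun c hc => by
    rw [hasFPowerSeriesAt_iff]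
    filter_upwards [hc] with x hx
    simpa [FormalMultilinearSeries.coeff_ofScalars, mul_comm] using hx
  have := (key a ha).eq_formalMultilinearSeries (key b hb)
  exact (FormalMultilinearSeries.ofScalars_series_eq_iff (𝕜 := ℝ) ℝ a b).1 this

theorem analyticAt_tsum {a : ℕ → ℝ} {y x : ℝ} (hxy : |x| < y)
    (h : Summable fun n => a n * y ^ n) : AnalyticAt ℝ (fun x => ∑' n, a n * x ^ n) x := by
  obtain ⟨w, hxw, hwy⟩ := exists_between hxy
  have hw : 0 < w := (abs_nonneg x).trans_lt hxw
  have hs := summable_abs_of_summable hw.le hwy h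
  have : HasFPowerSeriesAt (fun x => ∑' n, a n * x ^ n)
      (FormalMultilinearSeries.ofScalars ℝ (shiftCoeff a x)) x := by
    rw [hasFPowerSeriesAt_iff]
    filter_upwards [Metric.ball_mem_nhds (0 : ℝ) (sub_pos.2 hxw)] with z hz
    have hz' : |x| + |z| ≤ w := by
      have : |z| < w - |x| := by simpa using hz
      linarith
    have := hasSum_shiftCoeff (a := a) (d := x) (x := z) (Summable.of_nonneg_of_le
      (fun n => by positivity) (fun n => by gcongr) hs)
    simpa [FormalMultilinearSeries.coeff_ofScalars, mul_comm] using this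
  exact this.analyticAt

/-! ### Singularities of positive combinations -/

/-- Without its constant term a power series is divisible by the variable, which gains the factor `y
/ δ`. This makes the variation of an analytic function about its central value small in the ℓ¹ norm
of coefficients. -/
theorem tsum_abs_update_zero_le {a : ℕ → ℝ} {δ y : ℝ} (hδ : 0 < δ) (hy : 0 ≤ y) (hyδ : y ≤ δ)
    (h : Summable fun n => |a n| * δ ^ n) :
    Summable (fun n => |Function.update a 0 0 n| * y ^ n) ∧
      ∑' n, |Function.update a 0 0 n| * y ^ n ≤ y / δ * ∑' n, |a n| * δ ^ n := by
  have hle : ∀ n, |Function.update a 0 0 n| * y ^ n ≤ y / δ * (|a n| * δ ^ n) := by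
    intro n
    rcases n with _ | n
    · simp only [Function.update_self, abs_zero, zero_mul]
      positivity
    · rw [Function.update_of_ne (Nat.succ_ne_zero n)]
      calc |a (n + 1)| * y ^ (n + 1) = |a (n + 1)| * (y * y ^ n) := by ring
        _ ≤ |a (n + 1)| * (y * δ ^ n) := by gcongr
        _ = y / δ * (|a (n + 1)| * δ ^ (n + 1)) := by field_simp; ring
  have hS := Summable.of_nonneg_of_le (fun n => by positivity) hle (h.mul_left (y / δ))
  exact ⟨hS, by rw [← tsum_mul_left]; exact hS.tsum_le_tsum hle (h.mul_left _)⟩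

/-- Suppose the weighted sum `Y` at `n` exceeds `2B` for the first time. Then it dominates all
earlier sums, so each `c i j` with `j ≤ n` is at most `Y / ρ i`, and the small ℓ¹ norms keep all
convolutions together below `Y / 2`. This leaves `e n ≥ Y / 2 > B`. -/
theorem le_of_convolution_bound {ι : Type*} [Fintype ι] {ρ : ι → ℝ} (hρ : ∀ i, 0 < ρ i)
    {σ c : ι → ℕ → ℝ} (hc : ∀ i n, 0 ≤ c i n) {e : ℕ → ℝ} {B : ℝ} (hB : 0 ≤ B)
    (he : ∀ n, |e n| ≤ B) (hσs : ∀ i, Summable fun k => |σ i k|)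
    (hσ : ∀ i, ∑' k, |σ i k| ≤ ρ i / (2 * (Fintype.card ι + 1)))
    (h : ∀ n, e n = ∑ i, (ρ i * c i n +
      ∑ p ∈ Finset.HasAntidiagonal.antidiagonal n, σ i p.1 * c i p.2)) (n : ℕ) :
    ∑ i, ρ i * c i n ≤ 2 * B := by
  induction n using Nat.strong_induction_on with
  | _ n ih =>
  by_contra hlt
  push Not at hlt
  set Y := ∑ i, ρ i * c i n with hY
  have hYj : ∀ i, ∀ j ≤ n, c i j ≤ Y / ρ i := by
    intro i j hj
    have h1 : ρ i * c i j ≤ ∑ i, ρ i * c i j :=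
      Finset.single_le_sum (f := fun i => ρ i * c i j)
        (fun i _ => mul_nonneg (hρ i).le (hc i j)) (Finset.mem_univ i)
    rw [le_div_iff₀ (hρ i), mul_comm]
    rcases hj.lt_or_eq with hj | rfl
    · linarith [ih j hj]
    · exact h1
  have hY0 : 0 < Y := by linarith
  have hconv : ∀ i, |∑ p ∈ Finset.HasAntidiagonal.antidiagonal n, σ i p.1 * c i p.2|
      ≤ Y / (2 * (Fintype.card ι + 1)) := by
    intro i
    calc |∑ p ∈ Finset.HasAntidiagonal.antidiagonal n, σ i p.1 * c i p.2|
        ≤ ∑ p ∈ Finset.HasAntidiagonal.antidiagonal n, |σ i p.1| * (Y / ρ i) := by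
          refine (Finset.abs_sum_le_sum_abs _ _).trans (Finset.sum_le_sum fun p hp => ?_)
          rw [abs_mul, abs_of_nonneg (hc i _)]
          refine mul_le_mul_of_nonneg_left (hYj i _ ?_) (abs_nonneg _)
          rw [Finset.HasAntidiagonal.mem_antidiagonal] at hp
          omega
      _ = (∑ k ∈ Finset.range (n + 1), |σ i k|) * (Y / ρ i) := by
          rw [← Finset.sum_mul]
          congr 1
          exact Finset.Nat.sum_antidiagonal_eq_sum_range_succ_mk (fun p => |σ i p.1|) n
      _ ≤ ρ i / (2 * (Fintype.card ι + 1)) * (Y / ρ i) := by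
          refine mul_le_mul_of_nonneg_right ?_ (div_pos hY0 (hρ i)).le
          exact ((hσs i).sum_le_tsum _ fun _ _ => abs_nonneg _).trans (hσ i)
      _ = Y / (2 * (Fintype.card ι + 1)) := by
          have := (hρ i).ne'
          field_simp
  have hsum : |∑ i, ∑ p ∈ Finset.HasAntidiagonal.antidiagonal n, σ i p.1 * c i p.2| ≤ Y / 2 := by
    calc _ ≤ ∑ i : ι, Y / (2 * (Fintype.card ι + 1)) :=
          (Finset.abs_sum_le_sum_abs _ _).trans (Finset.sum_le_sum fun i _ => hconv i)
      _ = Fintype.card ι * (Y / (2 * (Fintype.card ι + 1))) := by simp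
      _ ≤ (Fintype.card ι + 1) * (Y / (2 * (Fintype.card ι + 1))) := by
          gcongr
          linarith
      _ = Y / 2 := by field_simp
  have hn := h n
  rw [Finset.sum_add_distrib, ← hY] at hn
  have h1 := (abs_le.1 (he n)).2
  have h2 := (abs_le.1 hsum).1
  linarith

/-- Let `F i` be power series with nonnegative coefficients converging on `[0, R)`, and `r i`
analytic at `R` and positive there. If `∑ r i * F i` continues analytically to `R`, then all `F i`
converge beyond `R`. -/
theorem exists_summable_of_analyticAt {ι : Type*} [Fintype ι] {f : ι → ℕ → ℝ}
    (hf : ∀ i n, 0 ≤ f i n) {R : ℝ} (hR : 0 < R)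
    (hs : ∀ i t, 0 ≤ t → t < R → Summable fun n => f i n * t ^ n)
    {r : ι → ℝ → ℝ} (hr : ∀ i, AnalyticAt ℝ (r i) R) (hpos : ∀ i, 0 < r i R)
    {E : ℝ → ℝ} (hE : AnalyticAt ℝ E R)
    (hEq : ∀ᶠ t in 𝓝[<] R, E t = ∑ i, r i t * ∑' n, f i n * t ^ n) :
    ∃ x > R, ∀ i, Summable fun n => f i n * x ^ n := by
  choose ρ δ hδ hρs hρ using fun i => exists_coeff_of_analyticAt (hr i)
  obtain ⟨e, η, hη, hes, he⟩ := exists_coeff_of_analyticAt hE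
  obtain ⟨l, hl, hlR⟩ := mem_nhdsLT_iff_exists_Ioo_subset.1 hEq
  have hρ0 : ∀ i, ρ i 0 = r i R := fun i => by
    have := hρ i 0 (by simpa using hδ i)
    rw [tsum_eq_single 0 (fun n hn => by simp [hn])] at this
    simpa using this.symm
  have hρpos : ∀ i, 0 < ρ i 0 := fun i => hρ0 i ▸ hpos i
  -- All series are re-expanded at `z = R - s/2`. A small `s` ensures that the expansions of the `r
  -- i` and of `E` at `z` still converge at distance `s`, beyond `R`, and that the nonconstant part
  -- of `r i` has ℓ¹ norm below the threshold of `le_of_convolution_bound`.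
  have hev : ∀ᶠ s in 𝓝[>] (0 : ℝ), 0 < s ∧ (∀ i, 2 * s < δ i) ∧ 2 * s < η ∧ s < R ∧ l < R - s ∧
      ∀ i, 2 * s / δ i * ∑' n, |ρ i n| * δ i ^ n < ρ i 0 / (2 * (Fintype.card ι + 1)) := by
    have hlt : ∀ {F : ℝ → ℝ} {c : ℝ}, Continuous F → F 0 < c → ∀ᶠ s in 𝓝[>] (0 : ℝ), F s < c :=
      fun hF hc => nhdsWithin_le_nhds (hF.continuousAt.eventually_lt continuousAt_const hc)
    have hl' : l < R := hl
    refine ((eventually_mem_nhdsWithin.mono fun _ h => h).and ((eventually_all.2 fun i => hlt (by fun_prop) ?_).and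
      ((hlt (by fun_prop) ?_).and ((hlt continuous_id hR).and
      (((hlt (F := fun s => l + s) (c := R) (by fun_prop) ?_).mono fun s hs => by linarith).and
      (eventually_all.2 fun i => hlt (by fun_prop) ?_))))))
    · simpa using hδ i
    · simpa using hη
    · simpa using hl'
    · have := hρpos i
      simp only [mul_zero, zero_div, zero_mul]
      positivity
  obtain ⟨s, hs0, hsδ, hsη, hsR, hsl, hsρ⟩ := hev.exists
  set d := s / 2 with hd
  set z := R - d with hz
  have hz0 : 0 ≤ z := by linarith
  set τ : ι → ℕ → ℝ := fun i => Function.update (ρ i) 0 0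
  set σ : ι → ℕ → ℝ := fun i => shiftCoeff (τ i) (-d)
  set c : ι → ℕ → ℝ := fun i => shiftCoeff (f i) z
  set ε : ℕ → ℝ := shiftCoeff e (-d)
  have habsd : |-d| = d := by rw [abs_neg, abs_of_pos]; linarith
  have hτs : ∀ i x, |x| ≤ s → Summable fun n => |τ i n| * (|-d| + |x|) ^ n := fun i x hx =>
    (tsum_abs_update_zero_le (hδ i) (by positivity) (by rw [habsd]; linarith [hsδ i]) (hρs i)).1
  have hess : ∀ x, |x| ≤ s → Summable fun n => |e n| * (|-d| + |x|) ^ n := fun x hx =>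
    Summable.of_nonneg_of_le (fun n => by positivity)
      (fun n => by gcongr; rw [habsd]; linarith) hes
  have hcs : ∀ i x, |x| < d → Summable fun n => |f i n| * (|z| + |x|) ^ n := fun i x hx => by
    simpa [abs_of_nonneg, hf, hz0] using hs i (z + |x|) (by positivity) (by linarith)
  -- `σ i` expands `r i - r i R` at `z`; the value at `R`, not at `z`, is split off.
  have hr' : ∀ i x, |x| ≤ s → HasSum (fun k => σ i k * x ^ k) (r i (z + x) - ρ i 0) := by
    intro i x hx
    convert hasSum_shiftCoeff (hτs i x hx) using 1
    have hdx : |-d + x| < δ i := (abs_add_le _ _).trans_lt (by rw [habsd]; linarith [hsδ i])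
    have h1 : Summable fun n => ρ i n * (-d + x) ^ n := by
      refine Summable.of_abs (Summable.of_nonneg_of_le (fun n => abs_nonneg _) (fun n => ?_)
        (hρs i))
      rw [abs_mul, abs_pow]
      gcongr
    have h2 : Summable fun n => τ i n * (-d + x) ^ n := by
      refine Summable.of_abs (Summable.of_nonneg_of_le (fun n => abs_nonneg _) (fun n => ?_)
        (hτs i x hx))
      rw [abs_mul, abs_pow]
      gcongr
      exact abs_add_le _ _
    have h3 := hρ i _ hdx
    rw [h1.tsum_eq_zero_add] at h3
    rw [h2.tsum_eq_zero_add, show z + x = R + (-d + x) by rw [hz]; ring, h3]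
    simp [τ]
  have hE' : ∀ x, |x| ≤ s → HasSum (fun k => ε k * x ^ k) (E (z + x)) := by
    intro x hx
    convert hasSum_shiftCoeff (hess x hx) using 1
    rw [show z + x = R + (-d + x) by rw [hz]; ring]
    exact he _ ((abs_add_le _ _).trans_lt (by rw [habsd]; linarith))
  have hF' : ∀ i x, |x| < d → HasSum (fun k => c i k * x ^ k) (∑' n, f i n * (z + x) ^ n) :=
    fun i x hx => hasSum_shiftCoeff (hcs i x hx)
  have hprod : ∀ x, |x| < d → HasSum (fun n => (∑ i, (ρ i 0 * c i n +
      ∑ p ∈ Finset.HasAntidiagonal.antidiagonal n, σ i p.1 * c i p.2)) * x ^ n)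
      (E (z + x)) := by
    intro x hx
    have hx1 := abs_lt.1 hx
    have : E (z + x) = ∑ i, (ρ i 0 * ∑' n, f i n * (z + x) ^ n +
        (r i (z + x) - ρ i 0) * ∑' n, f i n * (z + x) ^ n) := by
      rw [hlR (a := z + x) ⟨by linarith, by linarith⟩]
      exact Finset.sum_congr rfl fun i _ => by ring
    rw [this]
    simp_rw [Finset.sum_mul]
    refine hasSum_sum fun i _ => ?_
    simp_rw [add_mul]
    refine HasSum.add ?_ ?_
    · simpa [mul_assoc] using (hF' i x hx).mul_left (ρ i 0)
    · have hxs : |x| ≤ s := by linarith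
      obtain ⟨w, hxw, hwd⟩ := exists_between hx
      have hw0 : 0 < w := (abs_nonneg x).trans_lt hxw
      have habsw : |w| = w := abs_of_pos hw0
      have hσa : Summable fun k => ‖σ i k * x ^ k‖ := by
        simpa [abs_mul] using summable_abs_of_summable (abs_nonneg x) hxw
          (hr' i w (by rw [habsw]; linarith)).summable
      have hca : Summable fun k => ‖c i k * x ^ k‖ := by
        simpa [abs_mul] using summable_abs_of_summable (abs_nonneg x) hxw
          (hF' i w (by rw [habsw]; linarith)).summable
      rw [← (hr' i x hxs).tsum_eq, ← (hF' i x hx).tsum_eq,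
        tsum_mul_tsum_eq_tsum_sum_antidiagonal_of_summable_norm hσa hca]
      refine (summable_norm_sum_mul_antidiagonal_of_summable_norm hσa hca).of_norm.hasSum.congr_fun
        fun n => ?_
      rw [Finset.sum_mul]
      refine Finset.sum_congr rfl fun p hp => ?_
      rw [← Finset.HasAntidiagonal.mem_antidiagonal.1 hp]
      ring
  have hd0 : 0 < d := by linarith
  -- The product formula is available only for `|x| < d`, where the `F i` are known to converge. The
  -- resulting identity of coefficients is nevertheless usable at the larger radius `s`, where the
  -- coefficients of `E` and of the `r i` are controlled.
  have hcoef := coeff_unique (F := E) (z := z) (a := ε)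
    (by filter_upwards [Metric.ball_mem_nhds (0 : ℝ) hs0] with x hx
        exact hE' x (by simpa using (Metric.mem_ball.1 hx).le))
    (by filter_upwards [Metric.ball_mem_nhds (0 : ℝ) hd0] with x hx
        exact hprod x (by simpa using hx))
  have habss : |s| = s := abs_of_pos hs0
  obtain ⟨B, hB, hεB⟩ := exists_bound_of_summable (hE' s (by rw [habss])).summable
  have hc0 : ∀ i n, 0 ≤ c i n := fun i n => shiftCoeff_nonneg (hf i) hz0 n
  have hbound := le_of_convolution_bound (ρ := fun i => ρ i 0) hρpos
    (σ := fun i k => σ i k * s ^ k) (c := fun i k => c i k * s ^ k)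
    (fun i n => mul_nonneg (hc0 i n) (by positivity)) (e := fun k => ε k * s ^ k) hB hεB
    (fun i => by
      simpa [abs_mul, habss] using (hasSum_abs_shiftCoeff_le hs0.ne' (hτs i s (by rw [habss]))).1)
    (fun i => by
      have h1 := (hasSum_abs_shiftCoeff_le hs0.ne' (hτs i s (by rw [habss]))).2
      have h2 := (tsum_abs_update_zero_le (y := |-d| + |s|) (hδ i) (by positivity)
        (by rw [habsd, habss]; linarith [hsδ i]) (hρs i)).2
      have h3 : (|-d| + |s|) / δ i * ∑' n, |ρ i n| * δ i ^ n
          ≤ 2 * s / δ i * ∑' n, |ρ i n| * δ i ^ n := by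
        refine mul_le_mul_of_nonneg_right ?_ (tsum_nonneg fun n => ?_)
        · have := (hδ i).le
          rw [habsd, habss]
          gcongr
          linarith
        · have := (hδ i).le
          positivity
      calc ∑' k, |σ i k * s ^ k| = ∑' k, |σ i k| * |s| ^ k := by simp [abs_mul]
        _ ≤ _ := h1.trans (h2.trans (h3.trans (hsρ i).le)))
    (fun n => by
      rw [congrFun hcoef n, Finset.sum_mul]
      refine Finset.sum_congr rfl fun i _ => ?_
      rw [add_mul, Finset.sum_mul, mul_assoc]
      congr 1
      refine Finset.sum_congr rfl fun p hp => ?_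
      rw [← Finset.HasAntidiagonal.mem_antidiagonal.1 hp]
      ring)
  -- The coefficients `c i n` are `O(s⁻ⁿ)`, so the expansions at `z` converge at every distance
  -- below `s`; the point `z + 3s/4 = R + s/4` lies beyond `R`.
  refine ⟨z + 3 / 4 * s, by rw [hz, hd]; linarith, fun i => ?_⟩
  refine summable_of_summable_shiftCoeff (hf i) hz0 (by positivity) (half_pos hd0)
    (hs i _ (by positivity) (by linarith)) ?_
  have : Summable fun k => |c i k| * (3 / 4 * s) ^ k := by
    refine summable_abs_of_bounded (y := s) (B := 2 * B / ρ i 0) (by positivity) (by linarith)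
      fun n => ?_
    rw [abs_of_nonneg (hc0 i n), le_div_iff₀ (hρpos i), mul_comm]
    exact (Finset.single_le_sum (f := fun i => ρ i 0 * (c i n * s ^ n))
      (fun i _ => mul_nonneg (hρpos i).le (mul_nonneg (hc0 i n) (by positivity)))
      (Finset.mem_univ i)).trans (hbound n)
  exact this.congr fun k => by rw [abs_of_nonneg (hc0 i k)]

/-! ### Growth rates -/

theorem rpow_inv_le_of_le_pow {x y : ℝ} (hx : 0 ≤ x) (hy : 0 ≤ y) {n : ℕ} (hn : n ≠ 0)
    (h : x ≤ y ^ n) : x ^ (1 / (n : ℝ)) ≤ y := by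
  calc x ^ (1 / (n : ℝ)) ≤ (y ^ n) ^ (1 / (n : ℝ)) := by gcongr
    _ = y := by rw [one_div, Real.pow_rpow_inv_natCast hy hn]

/-- A `limsup` in `ℝ` takes a default value on unbounded sequences, so the bound `3 ^ n` accompanies
every use of `growthRate` as a true upper limit. -/
theorem isBoundedUnder_root {c : ℕ → ℕ} (hc : ∀ n, c n ≤ 3 ^ n) :
    IsBoundedUnder (· ≤ ·) atTop fun n : ℕ => (c n : ℝ) ^ (1 / (n : ℝ)) := by
  refine ⟨3, eventually_map.2 ?_⟩
  filter_upwards [eventually_ne_atTop 0] with n hn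
  exact rpow_inv_le_of_le_pow (by positivity) (by norm_num) hn (by exact_mod_cast hc n)

theorem isCoboundedUnder_root (c : ℕ → ℕ) :
    IsCoboundedUnder (· ≤ ·) atTop fun n : ℕ => (c n : ℝ) ^ (1 / (n : ℝ)) :=
  isCoboundedUnder_le_of_le atTop (x := 0) fun n => by positivity

theorem summable_of_mul_growthRate_lt_one {c : ℕ → ℕ} (hc : ∀ n, c n ≤ 3 ^ n) {t : ℝ} (ht : 0 ≤ t)
    (h : t * growthRate c < 1) : Summable fun n => (c n : ℝ) * t ^ n := by
  rcases ht.eq_or_lt with rfl | ht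
  · exact summable_of_ne_finset_zero (s := {0}) fun n hn => by
      simp [Finset.mem_singleton.not.1 hn]
  have h1 : growthRate c < 1 / t := by rw [lt_div_iff₀ ht]; linarith
  obtain ⟨y, hy1, hy2⟩ := exists_between h1
  have hev := eventually_lt_of_limsup_lt hy1 (isBoundedUnder_root hc)
  have hy0 : 0 ≤ y := by
    obtain ⟨n, hn⟩ := hev.exists
    exact le_trans (by positivity) hn.le
  have hg : Summable fun n : ℕ => (y * t) ^ n :=
    summable_geometric_of_lt_one (by positivity) (by rwa [lt_div_iff₀ ht] at hy2)
  refine hg.of_norm_bounded_eventually_nat ?_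
  filter_upwards [hev, eventually_ne_atTop 0] with n hn hn0
  have : (c n : ℝ) ≤ y ^ n := by
    calc (c n : ℝ) = ((c n : ℝ) ^ (1 / (n : ℝ))) ^ n := by
          rw [one_div, Real.rpow_inv_natCast_pow (by positivity) hn0]
      _ ≤ y ^ n := by gcongr
  rw [Real.norm_of_nonneg (by positivity), mul_pow]
  gcongr

theorem growthRate_le_of_bound {c : ℕ → ℕ} {C y : ℝ} (hy : 0 ≤ y)
    (h : ∀ n, (c n : ℝ) ≤ C * y ^ n) : growthRate c ≤ y := by
  have hC : 0 ≤ C := by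
    have := h 0
    simp only [pow_zero, mul_one] at this
    exact le_trans (by positivity) this
  -- `C + 1` replaces `C`, which may vanish, so that the `n`-th root tends to `1`.
  have hlim : Tendsto (fun n : ℕ => (C + 1) ^ (1 / (n : ℝ)) * y) atTop (𝓝 y) := by
    have : Tendsto (fun n : ℕ => (C + 1) ^ (1 / (n : ℝ))) atTop (𝓝 ((C + 1) ^ (0 : ℝ))) :=
      tendsto_const_nhds.rpow tendsto_one_div_atTop_nhds_zero_nat (Or.inl (by positivity))
    simpa using this.mul_const y
  rw [← hlim.limsup_eq]
  refine limsup_le_limsup ?_ (isCoboundedUnder_root c) hlim.isBoundedUnder_le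
  filter_upwards [eventually_ne_atTop 0] with n hn
  refine rpow_inv_le_of_le_pow (by positivity) (by positivity) hn ((h n).trans ?_)
  rw [mul_pow, one_div, Real.rpow_inv_natCast_pow (by positivity) hn]
  gcongr
  linarith

theorem growthRate_le_of_summable {c : ℕ → ℕ} {x : ℝ} (hx : 0 < x)
    (h : Summable fun n => (c n : ℝ) * x ^ n) : growthRate c ≤ 1 / x := by
  obtain ⟨B, hB0, hB⟩ := exists_bound_of_summable h
  refine growthRate_le_of_bound (C := B) (by positivity) fun n => ?_
  have := (le_abs_self _).trans (hB n)
  rw [one_div, inv_pow, ← div_eq_mul_inv, le_div_iff₀ (by positivity)]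
  exact this

theorem growthRate_nonneg (c : ℕ → ℕ) (hc : ∀ n, c n ≤ 3 ^ n) : 0 ≤ growthRate c :=
  le_limsup_of_frequently_le (Frequently.of_forall fun n => by positivity) (isBoundedUnder_root hc)

theorem le_growthRate_of_bound {c : ℕ → ℕ} (hc : ∀ n, c n ≤ 3 ^ n) {y : ℝ} (hy : 0 ≤ y)
    (h : ∀ n, y ^ n ≤ c n) : y ≤ growthRate c := by
  refine le_limsup_of_frequently_le (Eventually.frequently ?_) (isBoundedUnder_root hc)
  filter_upwards [eventually_ne_atTop 0] with n hn
  calc y = (y ^ n) ^ (1 / (n : ℝ)) := by rw [one_div, Real.pow_rpow_inv_natCast hy hn]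
    _ ≤ _ := by gcongr; exact h n

/-! ### The algebraic function `φ` and its companions -/

/-- The square root in `φ`. -/
def discRoot (t : ℝ) : ℝ := √(4 + 13 * t ^ 2 + 8 * t ^ 4)

/-- The square root of the quotient of the first-passage functions of `a` and of `b`, as a function
of the square root `t` of their product. -/
def passageRatio (t : ℝ) : ℝ := (discRoot t - t) / (2 * (1 + t ^ 2))

/-- The inverse of the Green function of the modular group, at `φ t`. -/
def greenInv (t : ℝ) : ℝ :=
  (1 - 2 * t ^ 4 + phi t * (t ^ 2 * (1 + 2 * t ^ 2))) / ((1 + t ^ 2) * (1 + 2 * t ^ 2))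

theorem discRoot_sq (t : ℝ) : discRoot t ^ 2 = 4 + 13 * t ^ 2 + 8 * t ^ 4 :=
  Real.sq_sqrt (by positivity)

theorem discRoot_pos (t : ℝ) : 0 < discRoot t := Real.sqrt_pos.2 (by positivity)

theorem lt_discRoot (t : ℝ) : t < discRoot t := by
  refine Real.lt_sqrt_of_sq_lt ?_
  nlinarith [sq_nonneg t, sq_nonneg (t ^ 2)]

theorem phi_mul (t : ℝ) : phi t * (1 + 2 * t ^ 2) = t * passageRatio t := by
  have h1 : (1 + t ^ 2) ≠ 0 := by positivity
  have h2 : (1 + 2 * t ^ 2) ≠ 0 := by positivity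
  unfold phi passageRatio discRoot
  field_simp

/-- With `pq = t²` the first-passage equations become `p = u(1 + 2t²)` and `q(1 - u) = u(1 + t²)`.
Multiplying them eliminates `p` and `q`; `φ` solves the result. -/
theorem phi_quadratic (t : ℝ) :
    phi t ^ 2 * ((1 + 2 * t ^ 2) * (1 + t ^ 2)) = t ^ 2 * (1 - phi t) := by
  have h1 : (1 + t ^ 2) ≠ 0 := by positivity
  have h2 : (1 + 2 * t ^ 2) ≠ 0 := by positivity
  have h := discRoot_sq t
  have hphi : phi t = (t * discRoot t - t ^ 2) / (2 * (1 + t ^ 2) * (1 + 2 * t ^ 2)) := rfl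
  rw [hphi]
  field_simp
  ring_nf
  rw [h]
  ring

theorem passageRatio_pos (t : ℝ) : 0 < passageRatio t :=
  div_pos (sub_pos.2 (lt_discRoot t)) (by positivity)

theorem phi_pos {t : ℝ} (ht : 0 < t) : 0 < phi t := by
  have h := phi_mul t
  have h2 : 0 < phi t * (1 + 2 * t ^ 2) := h ▸ mul_pos ht (passageRatio_pos t)
  exact pos_of_mul_pos_left h2 (by positivity)

theorem phi_zero : phi 0 = 0 := by simp [phi]

theorem phi_nonneg {t : ℝ} (ht : 0 ≤ t) : 0 ≤ phi t := by
  rcases ht.eq_or_lt with rfl | ht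
  · exact phi_zero.ge
  · exact (phi_pos ht).le

/-- The first-passage equation of the generator of order two. -/
theorem passage_eq_a {t : ℝ} :
    phi t + 2 * phi t * (t / passageRatio t) * (t * passageRatio t) = t * passageRatio t := by
  have h := (passageRatio_pos t).ne'
  rw [← phi_mul]
  field_simp
  linear_combination 2 * t * phi t * phi_mul t

/-- The first-passage equation of the generators of order three. -/
theorem passage_eq_b {t : ℝ} (ht : 0 < t) :
    phi t * (1 + t / passageRatio t + t * passageRatio t * (t / passageRatio t))
      = t / passageRatio t := by
  have h := (passageRatio_pos t).ne'
  have hu := (phi_pos ht).ne'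
  have hr : passageRatio t = phi t * (1 + 2 * t ^ 2) / t := by rw [phi_mul]; field_simp
  have h2 : (1 + 2 * t ^ 2) ≠ 0 := by positivity
  rw [hr]
  field_simp
  linear_combination phi_quadratic t

theorem greenInv_eq {t : ℝ} (ht : 0 < t) :
    phi t * (t * passageRatio t) + 2 * phi t * (t / passageRatio t) + greenInv t = 1 := by
  have h := (passageRatio_pos t).ne'
  have hu := (phi_pos ht).ne'
  have hr : passageRatio t = phi t * (1 + 2 * t ^ 2) / t := by rw [phi_mul]; field_simp
  have h1 : (1 + t ^ 2) ≠ 0 := by positivity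
  have h2 : (1 + 2 * t ^ 2) ≠ 0 := by positivity
  rw [hr, greenInv]
  field_simp
  linear_combination (1 + 2 * t ^ 2) * phi_quadratic t

/-- The numerator can fail to be positive only if `2t⁴ ≥ 1`. With `x = t²` and `w = u x(1 + 2x)`,
failure means `w ≤ 2x² - 1`, while the quadratic for `φ` reads `w²(1 + x) = x²(x(1 + 2x) - w)`.
Monotonicity in `w` on both sides gives `x² ≤ (2x² - 1)²`, that is `(4x² - 1)(1 - x²) ≤ 0`,
impossible for `1/2 ≤ x² < 1`. At `t = 1` the function vanishes, which is where `α > 1` comes from.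
-/
theorem greenInv_pos {t : ℝ} (ht0 : 0 ≤ t) (ht1 : t < 1) : 0 < greenInv t := by
  refine div_pos ?_ (by positivity)
  have hu := phi_nonneg ht0
  by_cases hle : 2 * t ^ 4 < 1
  · have : 0 ≤ phi t * (t ^ 2 * (1 + 2 * t ^ 2)) := by positivity
    linarith
  push Not at hle
  have ht : 0 < t := ht0.lt_of_ne (by rintro rfl; norm_num at hle)
  by_contra hneg
  push Not at hneg
  set x := t ^ 2 with hx
  have hx0 : 0 < x := by positivity
  have hx1 : x < 1 := by rw [hx]; nlinarith
  have hx4 : t ^ 4 = x ^ 2 := by rw [hx]; ring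
  rw [hx4] at hle hneg
  have hq := phi_quadratic t
  rw [← hx] at hq
  set u := phi t
  have hw : 0 ≤ u * (x * (1 + 2 * x)) := by positivity
  have hw2 : u * (x * (1 + 2 * x)) ≤ 2 * x ^ 2 - 1 := by linarith
  have hsq : (u * (x * (1 + 2 * x))) ^ 2 ≤ (2 * x ^ 2 - 1) ^ 2 := by gcongr
  have h3 : (u * (x * (1 + 2 * x))) ^ 2 * (1 + x)
      = x ^ 2 * (x * (1 + 2 * x) - u * (x * (1 + 2 * x))) := by
    linear_combination x ^ 2 * (1 + 2 * x) * hq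
  have h4 : x ^ 2 * (x * (1 + 2 * x) - (2 * x ^ 2 - 1)) ≤ (2 * x ^ 2 - 1) ^ 2 * (1 + x) := by
    calc _ ≤ x ^ 2 * (x * (1 + 2 * x) - u * (x * (1 + 2 * x))) := by gcongr
      _ = _ := h3.symm
      _ ≤ _ := by gcongr
  have h5 : (x + 1) * ((4 * x ^ 2 - 1) * (1 - x ^ 2)) ≤ 0 := by nlinarith
  have h6 : 0 < (x + 1) * ((4 * x ^ 2 - 1) * (1 - x ^ 2)) := by
    have : 0 < 4 * x ^ 2 - 1 := by linarith
    have : 0 < 1 - x ^ 2 := by nlinarith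
    positivity
  linarith

theorem analyticAt_discRoot (t : ℝ) : AnalyticAt ℝ discRoot t := by
  have h : AnalyticAt ℝ (fun t : ℝ => 4 + 13 * t ^ 2 + 8 * t ^ 4) t := by fun_prop
  have hne : 4 + 13 * t ^ 2 + 8 * t ^ 4 ≠ 0 := by positivity
  exact (Real.contDiffAt_sqrt hne).analyticAt.comp_of_eq h rfl

theorem analyticAt_phi (t : ℝ) : AnalyticAt ℝ phi t := by
  have h := analyticAt_discRoot t
  have : AnalyticAt ℝ (fun t => (t * discRoot t - t ^ 2) / (2 * (1 + t ^ 2) * (1 + 2 * t ^ 2))) t :=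
    AnalyticAt.div (by fun_prop) (by fun_prop) (by positivity)
  exact this

theorem analyticAt_passageRatio (t : ℝ) : AnalyticAt ℝ passageRatio t := by
  have h := analyticAt_discRoot t
  exact AnalyticAt.div (f := fun t => discRoot t - t) (by fun_prop) (by fun_prop) (by positivity)

theorem analyticAt_greenInv (t : ℝ) : AnalyticAt ℝ greenInv t := by
  have h := analyticAt_phi t
  exact AnalyticAt.div (f := fun t => 1 - 2 * t ^ 4 + phi t * (t ^ 2 * (1 + 2 * t ^ 2)))
    (by fun_prop) (by fun_prop) (by positivity)

theorem one_div_phi {t : ℝ} (ht : 0 < t) :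
    1 / phi t = 1 / 2 * √(8 * t ^ 2 + 13 + 4 * t⁻¹ ^ 2) + 1 / 2 := by
  have hs : √(8 * t ^ 2 + 13 + 4 * t⁻¹ ^ 2) = discRoot t / t := by
    rw [Real.sqrt_eq_iff_mul_self_eq (by positivity) (div_nonneg (discRoot_pos t).le ht.le)]
    have := discRoot_sq t
    field_simp
    linear_combination -this
  have h1 : (1 + t ^ 2) ≠ 0 := by positivity
  have h2 : (1 + 2 * t ^ 2) ≠ 0 := by positivity
  have h3 : discRoot t - t ≠ 0 := (sub_pos.2 (lt_discRoot t)).ne'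
  have hphi : phi t = (t * discRoot t - t ^ 2) / (2 * (1 + t ^ 2) * (1 + 2 * t ^ 2)) := rfl
  rw [hs, hphi, show t * discRoot t - t ^ 2 = t * (discRoot t - t) by ring]
  field_simp
  linear_combination -discRoot_sq t

/-- `1/φ` is an increasing function of `8t² + 4/t²`, which decreases until `2t⁴ = 1`. -/
theorem phi_lt_phi {s t : ℝ} (hs : 0 ≤ s) (hst : s < t) (ht : 2 * t ^ 4 ≤ 1) : phi s < phi t := by
  have ht0 : 0 < t := hs.trans_lt hst
  rcases hs.eq_or_lt with rfl | hs
  · rw [phi_zero]; exact phi_pos ht0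
  rw [← one_div_lt_one_div (phi_pos ht0) (phi_pos hs), one_div_phi ht0, one_div_phi hs]
  have h1 : s ^ 2 < t ^ 2 := by gcongr
  have h2 : 2 * (s ^ 2 * t ^ 2) < 1 := by
    have : s ^ 2 * t ^ 2 < t ^ 2 * t ^ 2 := by gcongr
    nlinarith
  have h3 : 8 * t ^ 2 + 13 + 4 * t⁻¹ ^ 2 < 8 * s ^ 2 + 13 + 4 * s⁻¹ ^ 2 := by
    rw [← sub_pos]
    have : 8 * s ^ 2 + 13 + 4 * s⁻¹ ^ 2 - (8 * t ^ 2 + 13 + 4 * t⁻¹ ^ 2)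
        = 4 * ((t ^ 2 - s ^ 2) * (1 - 2 * (s ^ 2 * t ^ 2))) / (s ^ 2 * t ^ 2) := by
      field_simp
      ring
    rw [this]
    have h4 : 0 < t ^ 2 - s ^ 2 := by linarith
    have h5 : 0 < 1 - 2 * (s ^ 2 * t ^ 2) := by linarith
    positivity
  have h4 := Real.sqrt_lt_sqrt (by positivity) h3
  linarith

/-! ### Systems of triangles and arcs -/

/-- Every vertex has an opposite vertex `a x` along an arc, and two neighbours `b₁ x` and `b₂ x`
that form a triangle with it, in an order that may depend on `x`. Arcs may join vertices of the
same triangle. -/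
structure StepSystem (V : Type*) where
  /-- the other end of the arc -/
  a : V → V
  /-- a neighbour in the triangle -/
  b₁ : V → V
  /-- the other neighbour in the triangle -/
  b₂ : V → V
  a_a : ∀ x, a (a x) = x
  b_b₁ : ∀ x, (b₁ (b₁ x) = x ∧ b₂ (b₁ x) = b₂ x) ∨ (b₁ (b₁ x) = b₂ x ∧ b₂ (b₁ x) = x)
  b_b₂ : ∀ x, (b₁ (b₂ x) = x ∧ b₂ (b₂ x) = b₁ x) ∨ (b₁ (b₂ x) = b₁ x ∧ b₂ (b₂ x) = x)

namespace StepSystem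

variable {V : Type*} (S : StepSystem V) (δ : V → ℕ)

/-- The number of paths of length `n` from `x`, weighted by the value of `δ` at the end. -/
def pathCount : ℕ → V → ℕ
  | 0, x => δ x
  | n + 1, x => pathCount n (S.a x) + pathCount n (S.b₁ x) + pathCount n (S.b₂ x)

/-- The numbers of reduced paths of length `n` from `x`, weighted by the value of `δ` at the end,
that do not start with a triangle edge, and that do not start with an arc. -/
def redPair : ℕ → V → ℕ × ℕ
  | 0, x => (δ x, δ x)
  | n + 1, x => ((redPair n (S.a x)).2, (redPair n (S.b₁ x)).1 + (redPair n (S.b₂ x)).1)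

/-- The number of reduced paths of length `n` from `x`, weighted by the value of `δ` at the end. -/
def redCount : ℕ → V → ℕ
  | 0, x => δ x
  | n + 1, x => (S.redPair δ (n + 1) x).1 + (S.redPair δ (n + 1) x).2

theorem pathCount_le (hδ : ∀ x, δ x ≤ 1) (n : ℕ) (x : V) : S.pathCount δ n x ≤ 3 ^ n := by
  induction n generalizing x with
  | zero => exact hδ x
  | succ n ih =>
    have h1 := ih (S.a x)
    have h2 := ih (S.b₁ x)
    have h3 := ih (S.b₂ x)
    rw [pathCount, pow_succ]
    omega

theorem redPair_le (hδ : ∀ x, δ x ≤ 1) (n : ℕ) (x : V) :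
    (S.redPair δ n x).1 ≤ 2 ^ n ∧ (S.redPair δ n x).2 ≤ 2 ^ n := by
  induction n generalizing x with
  | zero => exact ⟨hδ x, hδ x⟩
  | succ n ih =>
    have h1 := (ih (S.a x)).2
    have h2 := (ih (S.b₁ x)).1
    have h3 := (ih (S.b₂ x)).1
    simp only [redPair, pow_succ]
    omega

theorem redCount_le (hδ : ∀ x, δ x ≤ 1) (n : ℕ) (x : V) : S.redCount δ n x ≤ 3 ^ n := by
  rcases n with _ | n
  · exact hδ x
  · have h1 := (S.redPair_le δ hδ n (S.a x)).2
    have h2 := (S.redPair_le δ hδ (n + 1) x).2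
    have h3 : 2 ^ n ≤ 3 ^ n := Nat.pow_le_pow_left (by norm_num) n
    have h4 : (S.redPair δ (n + 1) x).1 = (S.redPair δ n (S.a x)).2 := rfl
    rw [redCount, h4]
    rw [pow_succ] at h2 ⊢
    omega

/-! ### The Green function -/

open scoped ENNReal

/-- The sum over the reduced paths from `x` that do not start with a triangle edge, where arcs have
weight `p` and triangle edges weight `q`. -/
def sumA (p q : ℝ≥0∞) (x : V) : ℝ≥0∞ :=
  ∑' n, ((S.redPair δ n x).1 : ℝ≥0∞) * (p ^ ((n + 1) / 2) * q ^ (n / 2))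

/-- The sum over the reduced paths from `x` that do not start with an arc, where arcs have
weight `p` and triangle edges weight `q`. -/
def sumB (p q : ℝ≥0∞) (x : V) : ℝ≥0∞ :=
  ∑' n, ((S.redPair δ n x).2 : ℝ≥0∞) * (p ^ (n / 2) * q ^ ((n + 1) / 2))

/-- The sum over all reduced paths from `x`, where arcs have weight `p` and triangle edges
weight `q`. -/
def sumRed (p q : ℝ≥0∞) (x : V) : ℝ≥0∞ :=
  δ x + p * S.sumB δ p q (S.a x) + q * (S.sumA δ p q (S.b₁ x) + S.sumA δ p q (S.b₂ x))

theorem mul_sumB (p q : ℝ≥0∞) (x : V) : p * S.sumB δ p q (S.a x) =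
    ∑' n, ((S.redPair δ (n + 1) x).1 : ℝ≥0∞) * (p ^ ((n + 1 + 1) / 2) * q ^ ((n + 1) / 2)) := by
  rw [sumB, ← ENNReal.tsum_mul_left]
  refine tsum_congr fun n => ?_
  rw [show (n + 1 + 1) / 2 = n / 2 + 1 by omega, redPair]
  ring

theorem mul_sumA_add (p q : ℝ≥0∞) (x : V) :
    q * (S.sumA δ p q (S.b₁ x) + S.sumA δ p q (S.b₂ x)) =
      ∑' n, ((S.redPair δ (n + 1) x).2 : ℝ≥0∞) * (p ^ ((n + 1) / 2) * q ^ ((n + 1 + 1) / 2)) := by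
  rw [sumA, sumA, ← ENNReal.tsum_add, ← ENNReal.tsum_mul_left]
  refine tsum_congr fun n => ?_
  rw [show (n + 1 + 1) / 2 = n / 2 + 1 by omega, redPair]
  push_cast
  ring

theorem sumA_eq (p q : ℝ≥0∞) (x : V) :
    S.sumA δ p q x = δ x + p * S.sumB δ p q (S.a x) := by
  rw [mul_sumB, sumA, tsum_eq_zero_add' ENNReal.summable]
  simp [redPair]

theorem sumB_eq (p q : ℝ≥0∞) (x : V) :
    S.sumB δ p q x = δ x + q * (S.sumA δ p q (S.b₁ x) + S.sumA δ p q (S.b₂ x)) := by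
  rw [mul_sumA_add, sumB, tsum_eq_zero_add' ENNReal.summable]
  simp [redPair]

/-- Only the symmetric sum over the two triangle neighbours matters, so their order, which may
change from vertex to vertex, drops out. -/
theorem add_triangle₁ (k : V → ℝ≥0∞) (x : V) :
    k (S.b₁ (S.b₁ x)) + k (S.b₂ (S.b₁ x)) = k x + k (S.b₂ x) := by
  rcases S.b_b₁ x with ⟨h1, h2⟩ | ⟨h1, h2⟩ <;> rw [h1, h2]
  exact add_comm _ _

theorem add_triangle₂ (k : V → ℝ≥0∞) (x : V) :
    k (S.b₁ (S.b₂ x)) + k (S.b₂ (S.b₂ x)) = k x + k (S.b₁ x) := by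
  rcases S.b_b₂ x with ⟨h1, h2⟩ | ⟨h1, h2⟩ <;> rw [h1, h2]
  exact add_comm _ _

/-- With weights that satisfy the first-passage equations, the sum over reduced paths is, up to the
factor `c`, a solution of the equation that defines the Green function. -/
theorem sumRed_eq {p q u c : ℝ≥0∞} (hp : u + 2 * u * q * p = p) (hq : u * (1 + q + p * q) = q)
    (hc : u * p + 2 * u * q + c = 1) (x : V) :
    S.sumRed δ p q x = c * δ x +
      u * (S.sumRed δ p q (S.a x) + S.sumRed δ p q (S.b₁ x) + S.sumRed δ p q (S.b₂ x)) := by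
  set A := S.sumA δ p q with hA
  set B := S.sumB δ p q with hB
  have hAx : ∀ y, A y = δ y + p * B (S.a y) := S.sumA_eq δ p q
  have hBx : ∀ y, B y = δ y + q * (A (S.b₁ y) + A (S.b₂ y)) := S.sumB_eq δ p q
  have ha : S.sumRed δ p q (S.a x) = p * B x + B (S.a x) := by
    rw [hBx (S.a x), sumRed, S.a_a]
    ring
  have hb : ∀ y, S.sumRed δ p q y = A y + q * (A (S.b₁ y) + A (S.b₂ y)) := fun y => by
    rw [hAx y, sumRed]
  rw [ha, hb (S.b₁ x), hb (S.b₂ x), S.add_triangle₁ A, S.add_triangle₂ A, hBx x, hAx x, sumRed]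
  rw [← hA, ← hB]
  set M := A (S.b₁ x) + A (S.b₂ x) with hM
  set D : ℝ≥0∞ := (δ x : ℝ≥0∞)
  set Y := B (S.a x)
  -- Reduced paths are sorted by their first edge: `D` is the empty path, `Y` carries those
  -- beginning with an arc, `M` those beginning with a triangle edge. The coefficients that arise
  -- are exactly the left-hand sides of `hc`, `hp` and `hq`. All is done in `ℝ≥0∞`, so no
  -- convergence at the neighbours of `x` is required.
  have key : c * D + u * (p * (D + q * M) + Y + (A (S.b₁ x) + q * (D + p * Y + A (S.b₂ x))) +
      (A (S.b₂ x) + q * (D + p * Y + A (S.b₁ x)))) =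
      (u * p + 2 * u * q + c) * D + (u + 2 * u * q * p) * Y + u * (1 + q + p * q) * M := by
    rw [hM]; ring
  rw [key, hp, hq, hc, one_mul]

theorem sum_pathCount_succ (u : ℝ≥0∞) (N : ℕ) (x : V) :
    ∑ n ∈ Finset.range N, (S.pathCount δ (n + 1) x : ℝ≥0∞) * u ^ (n + 1) =
      u * (∑ n ∈ Finset.range N, (S.pathCount δ n (S.a x) : ℝ≥0∞) * u ^ n +
        ∑ n ∈ Finset.range N, (S.pathCount δ n (S.b₁ x) : ℝ≥0∞) * u ^ n +
        ∑ n ∈ Finset.range N, (S.pathCount δ n (S.b₂ x) : ℝ≥0∞) * u ^ n) := by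
  rw [← Finset.sum_add_distrib, ← Finset.sum_add_distrib, Finset.mul_sum]
  refine Finset.sum_congr rfl fun n _ => ?_
  rw [pathCount]
  push_cast
  ring

/-- The path series times `c` is the minimal nonnegative solution of the Green equation: each
iteration exposes one more term and leaves a nonnegative remainder. -/
theorem mul_sum_pathCount_le {h : V → ℝ≥0∞} {u c : ℝ≥0∞}
    (H : ∀ x, h x = c * δ x + u * (h (S.a x) + h (S.b₁ x) + h (S.b₂ x))) (N : ℕ) (x : V) :
    c * ∑ n ∈ Finset.range N, (S.pathCount δ n x : ℝ≥0∞) * u ^ n ≤ h x := by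
  induction N generalizing x with
  | zero => simp
  | succ N ih =>
    rw [H x, Finset.sum_range_succ']
    have : c * (∑ n ∈ Finset.range N, (S.pathCount δ (n + 1) x : ℝ≥0∞) * u ^ (n + 1) +
        (S.pathCount δ 0 x : ℝ≥0∞) * u ^ 0) = c * δ x +
        u * (c * ∑ n ∈ Finset.range N, (S.pathCount δ n (S.a x) : ℝ≥0∞) * u ^ n +
          c * ∑ n ∈ Finset.range N, (S.pathCount δ n (S.b₁ x) : ℝ≥0∞) * u ^ n +
          c * ∑ n ∈ Finset.range N, (S.pathCount δ n (S.b₂ x) : ℝ≥0∞) * u ^ n) := by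
      rw [S.sum_pathCount_succ, pathCount]
      ring
    rw [this]
    gcongr
    · exact ih _
    · exact ih _
    · exact ih _

/-- After `N` iterations the remainder is a sum over `3 ^ N` paths, each with weight `u ^ N` and a
value of `h` bounded by `C`. -/
theorem le_mul_sum_pathCount_add {h : V → ℝ≥0∞} {u c C : ℝ≥0∞} (hC : ∀ x, h x ≤ C)
    (H : ∀ x, h x = c * δ x + u * (h (S.a x) + h (S.b₁ x) + h (S.b₂ x))) (N : ℕ) (x : V) :
    h x ≤ c * ∑ n ∈ Finset.range N, (S.pathCount δ n x : ℝ≥0∞) * u ^ n + (3 * u) ^ N * C := by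
  induction N generalizing x with
  | zero => simpa using hC x
  | succ N ih =>
    rw [H x, Finset.sum_range_succ', S.sum_pathCount_succ]
    calc _ ≤ c * δ x + u * ((c * ∑ n ∈ Finset.range N, (S.pathCount δ n (S.a x) : ℝ≥0∞) * u ^ n +
          (3 * u) ^ N * C) + (c * ∑ n ∈ Finset.range N, (S.pathCount δ n (S.b₁ x) : ℝ≥0∞) * u ^ n +
          (3 * u) ^ N * C) + (c * ∑ n ∈ Finset.range N, (S.pathCount δ n (S.b₂ x) : ℝ≥0∞) * u ^ n +
          (3 * u) ^ N * C)) := by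
          gcongr
          · exact ih _
          · exact ih _
          · exact ih _
      _ = _ := by
          rw [pathCount]
          ring

/-- At most `2 ^ n` reduced paths of each type have length `n`, so both partial sums are dominated
by `∑ (2/4)ⁿ = 2`. Only uniformity in `x` matters, not the value `5`. -/
theorem sumRed_le_five (hδ : ∀ x, δ x ≤ 1) {p q : ℝ≥0∞} (hp : p ≤ 1 / 4) (hq : q ≤ 1 / 4) (x : V) :
    S.sumRed δ p q x ≤ 5 := by
  have hgeo : ∑' n : ℕ, (2 * (1 / 4 : ℝ≥0∞)) ^ n = 2 := by
    rw [ENNReal.tsum_geometric]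
    have : (2 : ℝ≥0∞) * (1 / 4) = 2⁻¹ := by
      rw [show (4 : ℝ≥0∞) = 2 * 2 by norm_num, one_div, ENNReal.mul_inv (by simp) (by simp),
        ← mul_assoc, ENNReal.mul_inv_cancel (by simp) (by simp), one_mul]
    rw [this, ENNReal.one_sub_inv_two, inv_inv]
  have hterm : ∀ (m n i j : ℕ), m ≤ 2 ^ n → i + j = n →
      (m : ℝ≥0∞) * (p ^ i * q ^ j) ≤ (2 * (1 / 4)) ^ n := by
    intro m n i j hm hij
    calc (m : ℝ≥0∞) * (p ^ i * q ^ j) ≤ 2 ^ n * ((1 / 4) ^ i * (1 / 4) ^ j) := by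
          gcongr
          exact_mod_cast hm
      _ = _ := by rw [← pow_add, hij, mul_pow]
  have hA : ∀ y, S.sumA δ p q y ≤ 2 := fun y => by
    rw [← hgeo]
    exact ENNReal.tsum_le_tsum fun n => hterm _ n _ _ (S.redPair_le δ hδ n y).1 (by omega)
  have hB : ∀ y, S.sumB δ p q y ≤ 2 := fun y => by
    rw [← hgeo]
    exact ENNReal.tsum_le_tsum fun n => hterm _ n _ _ (S.redPair_le δ hδ n y).2 (by omega)
  have h14 : (1 / 4 : ℝ≥0∞) ≤ 1 := by
    rw [one_div]; exact ENNReal.inv_le_one.2 (by norm_num)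
  have hx : (δ x : ℝ≥0∞) ≤ 1 := by exact_mod_cast hδ x
  calc S.sumRed δ p q x ≤ 1 + 1 / 4 * 2 + 1 / 4 * (2 + 2) := by
        rw [sumRed]
        gcongr
        · exact hB _
        · exact hA _
        · exact hA _
    _ ≤ 1 + 1 * 2 + 1 / 4 * 4 := by
        refine add_le_add (add_le_add_right (mul_le_mul_left h14 _) _) (by norm_num)
    _ ≤ 5 := by
        rw [one_div, ENNReal.inv_mul_cancel (by simp) (by simp)]
        norm_num

end StepSystem

namespace StepSystem

variable {V : Type*} (S : StepSystem V) (δ : V → ℕ)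

open scoped ENNReal

/-! ### Comparison of the two series -/

/-- The numbers of reduced paths of even length, of those that start and end with an arc, and of
those that start and end with a triangle edge. -/
def redPart (i : Fin 3) (n : ℕ) (x : V) : ℕ :=
  ![if Even n then S.redCount δ n x else 0, if Even n then 0 else (S.redPair δ n x).1,
    if Even n then 0 else (S.redPair δ n x).2] i

/-- The weights of the three classes of reduced paths. -/
def partWeight (i : Fin 3) (t : ℝ) : ℝ := ![1, passageRatio t, (passageRatio t)⁻¹] i

theorem partWeight_pos (i : Fin 3) (t : ℝ) : 0 < partWeight i t := by
  have := passageRatio_pos t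
  fin_cases i
  · exact one_pos
  · exact this
  · exact inv_pos.2 this

theorem analyticAt_partWeight (i : Fin 3) (t : ℝ) : AnalyticAt ℝ (partWeight i) t := by
  have := analyticAt_passageRatio t
  fin_cases i
  · exact analyticAt_const
  · exact this
  · exact this.inv (passageRatio_pos t).ne'

theorem sum_redPart (n : ℕ) (x : V) : ∑ i, S.redPart δ i n x = S.redCount δ n x := by
  rw [Fin.sum_univ_three]
  by_cases h : Even n
  · simp [redPart, h]
  · rcases n with _ | n
    · simp at h
    · simp [redPart, h, redCount]

theorem redPart_le (i : Fin 3) (n : ℕ) (x : V) : S.redPart δ i n x ≤ S.redCount δ n x := by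
  rw [← S.sum_redPart]
  exact Finset.single_le_sum (f := fun i => S.redPart δ i n x) (fun _ _ => Nat.zero_le _)
    (Finset.mem_univ i)

theorem summable_redPart {t : ℝ} (ht : 0 ≤ t) {x : V}
    (h : Summable fun n => (S.redCount δ n x : ℝ) * t ^ n) (i : Fin 3) :
    Summable fun n => (S.redPart δ i n x : ℝ) * t ^ n := by
  refine Summable.of_nonneg_of_le (fun n => by positivity) (fun n => ?_) h
  gcongr
  exact S.redPart_le δ i n x

/-- The sum over reduced paths from `x` with the weights of the first-passage functions. -/
def weightedSeries (x : V) (t : ℝ) : ℝ :=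
  ∑ i, partWeight i t * ∑' n, (S.redPart δ i n x : ℝ) * t ^ n

/-- Edges alternate in type and `pq = t²`. Even length gives equally many arcs and triangle edges,
hence weight `tⁿ`; odd length leaves one surplus edge, which contributes an extra `r` or `1/r`. -/
theorem sumRed_eq_tsum {t : ℝ} (ht : 0 ≤ t) (x : V) :
    S.sumRed δ (ENNReal.ofReal (t * passageRatio t)) (ENNReal.ofReal (t / passageRatio t)) x =
      ∑' n, ENNReal.ofReal (∑ i, partWeight i t * ((S.redPart δ i n x : ℝ) * t ^ n)) := by
  have hr := passageRatio_pos t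
  have hp : 0 ≤ t * passageRatio t := by positivity
  have hq : 0 ≤ t / passageRatio t := by positivity
  rw [sumRed, mul_sumB, mul_sumA_add, add_assoc, ← ENNReal.tsum_add,
    tsum_eq_zero_add' (f := fun n => ENNReal.ofReal _) ENNReal.summable]
  congr 1
  · simp [Fin.sum_univ_three, redPart, redCount, partWeight]
  refine tsum_congr fun n => ?_
  rw [← ENNReal.ofReal_pow hp, ← ENNReal.ofReal_pow hp, ← ENNReal.ofReal_pow hq,
    ← ENNReal.ofReal_pow hq, ← ENNReal.ofReal_mul (by positivity),
    ← ENNReal.ofReal_mul (by positivity), ← ENNReal.ofReal_natCast, ← ENNReal.ofReal_natCast,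
    ← ENNReal.ofReal_mul (by positivity), ← ENNReal.ofReal_mul (by positivity),
    ← ENNReal.ofReal_add (by positivity) (by positivity)]
  congr 1
  rw [Fin.sum_univ_three]
  rcases Nat.even_or_odd' (n + 1) with ⟨m, hm | hm⟩
  · have he : Even (n + 1) := ⟨m, by omega⟩
    rw [show (n + 1 + 1) / 2 = m by omega, show (n + 1) / 2 = m by omega]
    simp only [redPart, partWeight, he, if_true, redCount]
    have : t ^ (n + 1) = (t * passageRatio t) ^ m * (t / passageRatio t) ^ m := by
      rw [← mul_pow, hm, pow_mul]
      congr 1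
      field_simp
    rw [this]
    simp
    ring
  · have he : ¬ Even (n + 1) := by rw [Nat.not_even_iff_odd]; exact ⟨m, hm⟩
    rw [show (n + 1 + 1) / 2 = m + 1 by omega, show (n + 1) / 2 = m by omega]
    simp only [redPart, partWeight, he, if_false]
    have : t ^ (n + 1) = t * ((t * passageRatio t) ^ m * (t / passageRatio t) ^ m) := by
      rw [← mul_pow, hm, pow_succ, pow_mul, mul_comm]
      congr 2
      field_simp
    rw [this, pow_succ, pow_succ]
    generalize (t * passageRatio t) ^ m = P
    generalize (t / passageRatio t) ^ m = Q
    simp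
    ring

theorem weightedSeries_nonneg {t : ℝ} (ht : 0 ≤ t) (x : V) : 0 ≤ S.weightedSeries δ x t :=
  Finset.sum_nonneg fun i _ => mul_nonneg (partWeight_pos i t).le
    (tsum_nonneg fun n => by positivity)

theorem sumRed_eq_ofReal {t : ℝ} (ht : 0 ≤ t) {x : V}
    (h : Summable fun n => (S.redCount δ n x : ℝ) * t ^ n) :
    S.sumRed δ (ENNReal.ofReal (t * passageRatio t)) (ENNReal.ofReal (t / passageRatio t)) x =
      ENNReal.ofReal (S.weightedSeries δ x t) := by
  have hs : ∀ i, Summable fun n => partWeight i t * ((S.redPart δ i n x : ℝ) * t ^ n) :=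
    fun i => (S.summable_redPart δ ht h i).mul_left _
  rw [S.sumRed_eq_tsum δ ht, ← ENNReal.ofReal_tsum_of_nonneg]
  · rw [Summable.tsum_finsetSum fun i _ => hs i]
    simp only [tsum_mul_left, weightedSeries]
  · exact fun n => Finset.sum_nonneg fun i _ =>
      mul_nonneg (partWeight_pos i t).le (by positivity)
  · exact summable_sum fun i _ => hs i

theorem green_equation {t : ℝ} (ht0 : 0 < t) (ht1 : t < 1) (x : V) :
    let h := S.sumRed δ (ENNReal.ofReal (t * passageRatio t)) (ENNReal.ofReal (t / passageRatio t))
    h x = ENNReal.ofReal (greenInv t) * δ x +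
      ENNReal.ofReal (phi t) * (h (S.a x) + h (S.b₁ x) + h (S.b₂ x)) := by
  have hr := passageRatio_pos t
  have hu := (phi_pos ht0).le
  have hc := (greenInv_pos ht0.le ht1).le
  have hp : 0 ≤ t * passageRatio t := by positivity
  have hq : 0 ≤ t / passageRatio t := by positivity
  have h2 : (2 : ℝ≥0∞) = ENNReal.ofReal 2 := by simp
  have h1 : (1 : ℝ≥0∞) = ENNReal.ofReal 1 := by simp
  refine S.sumRed_eq δ ?_ ?_ ?_ x
  · rw [h2, ← ENNReal.ofReal_mul (by positivity), ← ENNReal.ofReal_mul (by positivity),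
      ← ENNReal.ofReal_mul (by positivity), ← ENNReal.ofReal_add (by positivity) (by positivity),
      passage_eq_a]
  · rw [h1, ← ENNReal.ofReal_mul hp, ← ENNReal.ofReal_add zero_le_one hq,
      ← ENNReal.ofReal_add (by positivity) (by positivity), ← ENNReal.ofReal_mul (by positivity),
      passage_eq_b ht0]
  · rw [h2, h1, ← ENNReal.ofReal_mul (by positivity), ← ENNReal.ofReal_mul (by positivity),
      ← ENNReal.ofReal_mul (by positivity), ← ENNReal.ofReal_add (by positivity) (by positivity),
      ← ENNReal.ofReal_add (by positivity) (by positivity), greenInv_eq ht0]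

theorem ofReal_mul_sum_pathCount {u c : ℝ} (hu : 0 ≤ u) (hc : 0 ≤ c) (N : ℕ) (x : V) :
    ENNReal.ofReal c * ∑ n ∈ Finset.range N, (S.pathCount δ n x : ℝ≥0∞) * ENNReal.ofReal u ^ n =
      ENNReal.ofReal (c * ∑ n ∈ Finset.range N, (S.pathCount δ n x : ℝ) * u ^ n) := by
  rw [ENNReal.ofReal_mul hc, ENNReal.ofReal_sum_of_nonneg fun n _ => by positivity]
  congr 1
  refine Finset.sum_congr rfl fun n _ => ?_
  rw [ENNReal.ofReal_mul (by positivity), ENNReal.ofReal_natCast, ENNReal.ofReal_pow hu]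

/-- The series of all paths converges at `φ t` if the series of reduced paths converges at `t`. -/
theorem summable_pathCount {t : ℝ} (ht0 : 0 < t) (ht1 : t < 1) {x : V}
    (h : Summable fun n => (S.redCount δ n x : ℝ) * t ^ n) :
    Summable fun n => (S.pathCount δ n x : ℝ) * phi t ^ n := by
  have hu := (phi_pos ht0).le
  have hc := greenInv_pos ht0.le ht1
  refine summable_of_sum_range_le (c := S.weightedSeries δ x t / greenInv t)
    (fun n => by positivity) fun N => ?_
  have := S.mul_sum_pathCount_le δ (S.green_equation δ ht0 ht1) N x
  rw [S.sumRed_eq_ofReal δ ht0.le h, S.ofReal_mul_sum_pathCount δ hu hc.le,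
    ENNReal.ofReal_le_ofReal_iff (S.weightedSeries_nonneg δ ht0.le x)] at this
  rwa [le_div_iff₀ hc, mul_comm]

/-- Minimality gives one inequality. For the other, weights at most `1/4` bound the solution
uniformly, and `3φ(t) < 1` makes the remainder vanish. -/
theorem mul_series_pathCount_eq (hδ : ∀ x, δ x ≤ 1) {t : ℝ} (ht0 : 0 < t) (ht1 : t < 1)
    (hu4 : phi t ≤ 1 / 4) (hp4 : t * passageRatio t ≤ 1 / 4) (hq4 : t / passageRatio t ≤ 1 / 4)
    {x : V} (h : Summable fun n => (S.redCount δ n x : ℝ) * t ^ n) :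
    greenInv t * series (fun n => S.pathCount δ n x) (phi t) = S.weightedSeries δ x t := by
  have hu := (phi_pos ht0).le
  have hc := greenInv_pos ht0.le ht1
  have hs := S.summable_pathCount δ ht0 ht1 h
  have hw := S.weightedSeries_nonneg δ ht0.le x
  have h14 : ∀ {y : ℝ}, y ≤ 1 / 4 → ENNReal.ofReal y ≤ 1 / 4 := fun {y} hy => by
    refine (ENNReal.ofReal_le_ofReal hy).trans_eq ?_
    rw [ENNReal.ofReal_div_of_pos (by norm_num)]
    simp
  have hlim := (hs.hasSum.tendsto_sum_nat.const_mul (greenInv t))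
  refine le_antisymm (le_of_tendsto' hlim fun N => ?_) ?_
  · have := S.mul_sum_pathCount_le δ (S.green_equation δ ht0 ht1) N x
    rwa [S.sumRed_eq_ofReal δ ht0.le h, S.ofReal_mul_sum_pathCount δ hu hc.le,
      ENNReal.ofReal_le_ofReal_iff hw] at this
  · have hlim2 : Tendsto (fun N : ℕ => (3 * phi t) ^ N * 5) atTop (𝓝 (0 * 5)) :=
      (tendsto_pow_atTop_nhds_zero_of_lt_one (by positivity) (by linarith)).mul_const 5
    have hlim3 := hlim.add hlim2
    rw [zero_mul, add_zero] at hlim3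
    refine ge_of_tendsto' hlim3 fun N => ?_
    have := S.le_mul_sum_pathCount_add δ (S.sumRed_le_five δ hδ (h14 hp4) (h14 hq4))
      (S.green_equation δ ht0 ht1) N x
    have h5 : (3 * ENNReal.ofReal (phi t)) ^ N * 5 = ENNReal.ofReal ((3 * phi t) ^ N * 5) := by
      rw [ENNReal.ofReal_mul (by positivity), ENNReal.ofReal_pow (by positivity),
        ENNReal.ofReal_mul (by norm_num)]
      simp
    rwa [S.sumRed_eq_ofReal δ ht0.le h, S.ofReal_mul_sum_pathCount δ hu hc.le, h5,
      ← ENNReal.ofReal_add (mul_nonneg hc.le (Finset.sum_nonneg fun n _ => by positivity))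
        (by positivity),
      ENNReal.ofReal_le_ofReal_iff (add_nonneg (mul_nonneg hc.le
        (Finset.sum_nonneg fun n _ => by positivity)) (by positivity))] at this

/-! ### The comparison theorem -/

/-- The analytic continuation of the series of all paths at `φ t`. -/
def continuation (x : V) (t : ℝ) : ℝ :=
  ∑ i, partWeight i t / greenInv t * ∑' n, (S.redPart δ i n x : ℝ) * t ^ n

theorem continuation_eq (x : V) (t : ℝ) :
    S.continuation δ x t = S.weightedSeries δ x t / greenInv t := by
  rw [continuation, weightedSeries, Finset.sum_div]
  exact Finset.sum_congr rfl fun i _ => by ring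

variable {δ}

theorem summable_redCount (hδ : ∀ x, δ x ≤ 1) {o : V}
    (hα : 1 < growthRate fun n => S.redCount δ n o) {t : ℝ} (ht : 0 ≤ t)
    (htR : t < 1 / growthRate fun n => S.redCount δ n o) :
    Summable fun n => (S.redCount δ n o : ℝ) * t ^ n :=
  summable_of_mul_growthRate_lt_one (fun n => S.redCount_le δ hδ n o) ht
    (by rwa [lt_div_iff₀ (by linarith)] at htR)

theorem analyticOnNhd_continuation (hδ : ∀ x, δ x ≤ 1) {o : V}
    (hα : 1 < growthRate fun n => S.redCount δ n o) :
    AnalyticOnNhd ℝ (S.continuation δ o)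
      (Set.Ico 0 (1 / growthRate fun n => S.redCount δ n o)) := by
  intro t ht
  set R := 1 / growthRate fun n => S.redCount δ n o with hR
  have hR1 : R < 1 := by rw [hR, div_lt_one (by linarith)]; exact hα
  have : AnalyticAt ℝ (fun t => ∑ i, partWeight i t / greenInv t *
      ∑' n, (S.redPart δ i n o : ℝ) * t ^ n) t := by
    refine Finset.analyticAt_fun_sum _ fun i _ => ?_
    obtain ⟨y, hty, hyR⟩ := exists_between ht.2
    refine ((analyticAt_partWeight i t).div (analyticAt_greenInv t)
      (greenInv_pos ht.1 (ht.2.trans hR1)).ne').mul ?_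
    exact analyticAt_tsum (y := y) (by rwa [abs_of_nonneg ht.1])
      (S.summable_redPart δ (ht.1.trans hty.le)
        (S.summable_redCount hδ hα (ht.1.trans hty.le) hyR) i)
  exact this

theorem analyticAt_series {c : ℕ → ℕ} {x y : ℝ} (hxy : |x| < y)
    (h : Summable fun n => (c n : ℝ) * y ^ n) : AnalyticAt ℝ (series c) x :=
  analyticAt_tsum hxy h

/-- The exact identity is available only for small `t > 0`. Both sides are analytic at `0`, the
right one because `G` converges at `φ(R/2) > 0`, so the identity theorem extends it to a
neighbourhood. -/
theorem continuation_eventuallyEq (hδ : ∀ x, δ x ≤ 1) {o : V}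
    (hα : 1 < growthRate fun n => S.redCount δ n o) :
    S.continuation δ o =ᶠ[𝓝 0] fun t => series (fun n => S.pathCount δ n o) (phi t) := by
  set R := 1 / growthRate fun n => S.redCount δ n o with hR
  have hR0 : 0 < R := by rw [hR]; positivity
  have hR1 : R < 1 := by rw [hR, div_lt_one (by linarith)]; exact hα
  have han : AnalyticAt ℝ (fun t => series (fun n => S.pathCount δ n o) (phi t)) 0 := by
    refine AnalyticAt.fun_comp ?_ (analyticAt_phi 0)
    rw [phi_zero]
    exact analyticAt_series (y := phi (R / 2)) (by simpa using phi_pos (half_pos hR0))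
      (S.summable_pathCount δ (half_pos hR0) (by linarith)
        (S.summable_redCount hδ hα (half_pos hR0).le (half_lt_self hR0)))
  refine (AnalyticAt.frequently_eq_iff_eventually_eq
    (S.analyticOnNhd_continuation hδ hα 0 ⟨le_rfl, hR0⟩) han).1 ?_
  have hlt : ∀ {F : ℝ → ℝ} {c : ℝ}, ContinuousAt F 0 → F 0 < c → ∀ᶠ s in 𝓝[>] (0 : ℝ), F s < c :=
    fun hF hc => nhdsWithin_le_nhds (hF.eventually_lt continuousAt_const hc)
  have hr := (analyticAt_passageRatio 0).continuousAt
  have hev : ∀ᶠ t in 𝓝[>] (0 : ℝ),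
      S.continuation δ o t = series (fun n => S.pathCount δ n o) (phi t) := by
    filter_upwards [self_mem_nhdsWithin, hlt continuousAt_id hR0,
      hlt (analyticAt_phi 0).continuousAt (c := 1 / 4) (by rw [phi_zero]; norm_num),
      hlt (F := fun t => t * passageRatio t) (c := 1 / 4) (continuousAt_id.mul hr) (by norm_num),
      hlt (F := fun t => t / passageRatio t) (c := 1 / 4)
        (continuousAt_id.div hr (passageRatio_pos 0).ne') (by norm_num)]
      with t ht0 htR h1 h2 h3
    have ht1 : t < 1 := lt_trans htR hR1
    rw [S.continuation_eq, ← S.mul_series_pathCount_eq δ hδ ht0 ht1 h1.le h2.le h3.le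
      (S.summable_redCount hδ hα (le_of_lt ht0) htR), mul_div_cancel_left₀]
    exact (greenInv_pos (le_of_lt ht0) ht1).ne'
  exact hev.frequently.filter_mono (nhdsWithin_mono 0 fun t ht => ne_of_gt ht)

theorem series_redCount_eq {t : ℝ} (ht : 0 ≤ t) {x : V}
    (h : Summable fun n => (S.redCount δ n x : ℝ) * t ^ n) :
    series (fun n => S.redCount δ n x) t = ∑ i, ∑' n, (S.redPart δ i n x : ℝ) * t ^ n := by
  rw [← Summable.tsum_finsetSum fun i _ => S.summable_redPart δ ht h i, series]
  refine tsum_congr fun n => ?_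
  rw [← Finset.sum_mul, ← S.sum_redPart]
  push_cast
  rfl

theorem one_le_series_redCount {t : ℝ} (ht : 0 ≤ t) {o : V} (ho : δ o = 1)
    (h : Summable fun n => (S.redCount δ n o : ℝ) * t ^ n) :
    1 ≤ series (fun n => S.redCount δ n o) t := by
  refine le_trans ?_ (h.le_tsum 0 fun n _ => by positivity)
  simp [redCount, ho]

theorem two_mul_pow_le_of_le {α t : ℝ} (hα : √(√2) ≤ α) (ht : 0 ≤ t) (htα : t ≤ 1 / α) :
    2 * t ^ 4 ≤ 1 := by
  have h0 : (0 : ℝ) < √(√2) := Real.sqrt_pos.2 (Real.sqrt_pos.2 (by norm_num))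
  have h2 : (√(√2) : ℝ) ^ 4 = 2 := by
    rw [show 4 = 2 * 2 by norm_num, pow_mul, Real.sq_sqrt (Real.sqrt_nonneg _),
      Real.sq_sqrt (by norm_num)]
  have h3 : √(√2) * t ≤ 1 := by
    have hα0 := (h0.trans_le hα).le
    calc √(√2) * t ≤ α * (1 / α) := by gcongr
      _ = 1 := by field_simp [(h0.trans_le hα).ne']
  calc 2 * t ^ 4 = (√(√2) * t) ^ 4 := by rw [mul_pow, h2]
    _ ≤ 1 := pow_le_one₀ (by positivity) h3

theorem equivPhi (hδ : ∀ x, δ x ≤ 1) {o : V} (ho : δ o = 1)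
    (hα : 1 < growthRate fun n => S.redCount δ n o) :
    EquivPhi (fun n => S.redCount δ n o) (fun n => S.pathCount δ n o) := by
  set R := 1 / growthRate fun n => S.redCount δ n o with hR
  have hR0 : 0 < R := by rw [hR]; positivity
  have hR1 : R < 1 := by rw [hR, div_lt_one (by linarith)]; exact hα
  have hsum : ∀ {t}, 0 ≤ t → t < R → Summable fun n => (S.redCount δ n o : ℝ) * t ^ n :=
    fun h0 h1 => S.summable_redCount hδ hα h0 h1
  have hH := S.analyticOnNhd_continuation hδ hα
  have hgerm := S.continuation_eventuallyEq hδ hα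
  have hcoef : ∀ i, AnalyticAt ℝ (fun t => partWeight i t / greenInv t) R := fun i =>
    (analyticAt_partWeight i R).div (analyticAt_greenInv R) (greenInv_pos hR0.le hR1).ne'
  have hcpos : ∀ i, 0 < partWeight i R / greenInv R := fun i =>
    div_pos (partWeight_pos i R) (greenInv_pos hR0.le hR1)
  refine ⟨S.continuation δ o, ⟨hR0, hH, hgerm, ?_⟩, ?_, ?_⟩
  · rintro ⟨H', hH', hg'⟩
    -- A continuation up to `R` must agree with `continuation` on `[0, R)`. This is a positive
    -- analytic combination of the three partial series, so all three, and hence `F`, would converge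
    -- beyond `R = 1/α`.
    have hEq : Set.EqOn H' (S.continuation δ o) (Set.Ico 0 R) :=
      AnalyticOnNhd.eqOn_of_preconnected_of_eventuallyEq (hH'.mono Set.Ico_subset_Icc_self) hH
        isPreconnected_Ico ⟨le_rfl, hR0⟩ (hg'.trans hgerm.symm)
    obtain ⟨x, hxR, hx⟩ := exists_summable_of_analyticAt
      (f := fun i n => (S.redPart δ i n o : ℝ)) (fun i n => by positivity) hR0
      (fun i t h0 h1 => S.summable_redPart δ h0 (hsum h0 h1) i) hcoef hcpos
      (hH' R ⟨hR0.le, le_rfl⟩) (by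
        filter_upwards [Ioo_mem_nhdsLT hR0] with t ht
        exact hEq ⟨ht.1.le, ht.2⟩)
    have hs : Summable fun n => (S.redCount δ n o : ℝ) * x ^ n := by
      refine (summable_sum fun i (_ : i ∈ Finset.univ) => hx i).congr fun n => ?_
      rw [← S.sum_redPart, ← Finset.sum_mul]
      push_cast
      rfl
    have h1 := growthRate_le_of_summable (hR0.trans hxR) hs
    rw [le_div_iff₀ (hR0.trans hxR)] at h1
    rw [hR, gt_iff_lt, div_lt_iff₀ (by linarith)] at hxR
    linarith
  · obtain ⟨m, hm0, hm⟩ : ∃ m : ℝ, 0 < m ∧ ∀ i, m < partWeight i R / greenInv R := by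
      obtain ⟨i₀, h⟩ := Finite.exists_min fun i => partWeight i R / greenInv R
      exact ⟨_, half_pos (hcpos i₀), fun i => (half_lt_self (hcpos i₀)).trans_le (h i)⟩
    obtain ⟨M, hM⟩ : ∃ M : ℝ, ∀ i, partWeight i R / greenInv R < M := by
      obtain ⟨i₀, h⟩ := Finite.exists_max fun i => partWeight i R / greenInv R
      exact ⟨_, fun i => (h i).trans_lt (lt_add_one _)⟩
    have hM0 : 0 < M := (hcpos 0).trans (hM 0)
    -- Near `R` all weights lie between `m` and `M`, so `m F ≤ H ≤ M F`; one constant exceeds both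
    -- `M` and `1 / m`, strictly.
    refine ⟨M + 1 / m + 1, by positivity, ?_⟩
    have h1 : ∀ᶠ t in 𝓝[<] R, ∀ i, m < partWeight i t / greenInv t ∧
        partWeight i t / greenInv t < M :=
      eventually_all.2 fun i => nhdsWithin_le_nhds
        ((continuousAt_const.eventually_lt (hcoef i).continuousAt (hm i)).and
          ((hcoef i).continuousAt.eventually_lt continuousAt_const (hM i)))
    filter_upwards [h1, Ioo_mem_nhdsLT hR0] with t hw ht
    have hF1 := S.one_le_series_redCount ht.1.le ho (hsum ht.1.le ht.2)
    have hF := S.series_redCount_eq ht.1.le (hsum ht.1.le ht.2)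
    set F := series (fun n => S.redCount δ n o) t
    have hlow : m * F ≤ S.continuation δ o t := by
      rw [hF, Finset.mul_sum]
      exact Finset.sum_le_sum fun i _ => mul_le_mul_of_nonneg_right (hw i).1.le
        (tsum_nonneg fun n => mul_nonneg (by positivity) (pow_nonneg ht.1.le n))
    have hup : S.continuation δ o t ≤ M * F := by
      rw [hF, Finset.mul_sum]
      exact Finset.sum_le_sum fun i _ => mul_le_mul_of_nonneg_right (hw i).2.le
        (tsum_nonneg fun n => mul_nonneg (by positivity) (pow_nonneg ht.1.le n))
    have hF0 : 0 < F := by linarith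
    have hH0 : 0 < S.continuation δ o t := lt_of_lt_of_le (by positivity) hlow
    have hm1 : 1 / m * m = 1 := by field_simp
    constructor
    · rw [div_lt_div_iff₀ (by positivity) hH0, one_mul]
      calc _ ≤ M * F := hup
        _ < F * (M + 1 / m + 1) := by nlinarith [one_div_pos.2 hm0]
    · rw [div_lt_iff₀ hH0]
      calc F = 1 / m * (m * F) := by rw [← mul_assoc, hm1, one_mul]
        _ ≤ 1 / m * S.continuation δ o t := by gcongr
        _ < _ := by nlinarith
  · intro hα4
    have hpos : ∀ {t}, t ∈ Set.Ico (0 : ℝ) R →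
        Summable fun n => (S.pathCount δ n o : ℝ) * phi t ^ n := by
      intro t ht
      rcases ht.1.eq_or_lt with h0 | h0
      · subst h0
        rw [phi_zero]
        exact summable_of_ne_finset_zero (s := {0}) fun n hn => by
          simp [Finset.mem_singleton.not.1 hn]
      · exact S.summable_pathCount δ h0 (ht.2.trans hR1) (hsum ht.1 ht.2)
    -- Analyticity of `G` at `φ(t)` needs convergence at a larger point. Monotonicity of `φ`
    -- supplies it: `φ(y) > φ(t)` for `t < y < R`.
    have han : AnalyticOnNhd ℝ (fun t => series (fun n => S.pathCount δ n o) (phi t))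
        (Set.Ico 0 R) := by
      intro t ht
      obtain ⟨y, hty, hyR⟩ := exists_between ht.2
      have hy0 := ht.1.trans hty.le
      refine AnalyticAt.fun_comp (analyticAt_series (y := phi y) ?_ (hpos ⟨hy0, hyR⟩))
        (analyticAt_phi t)
      rw [abs_of_nonneg (phi_nonneg ht.1)]
      exact phi_lt_phi ht.1 hty (two_mul_pow_le_of_le hα4 hy0 hyR.le)
    intro t ht
    exact ⟨hpos ht, AnalyticOnNhd.eqOn_of_preconnected_of_eventuallyEq hH han
      isPreconnected_Ico ⟨le_rfl, hR0⟩ hgerm ht⟩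

end StepSystem

/-! ### Growth rates in the convergent range -/

/-- Convergence of `G` at `φ(t)` for all `t < R` gives `ν ≤ 1/φ(R)`. Were the inequality strict, `G`
would be analytic on all of `[0, φ(R)]`, which contains `φ([0, R])`, contradicting the singularity
of `G ∘ φ` at `R`. -/
theorem EquivPhi.one_div_growthRate {f g : ℕ → ℕ} (h : EquivPhi f g) (hg : ∀ n, g n ≤ 3 ^ n)
    (hα : √(√2) ≤ growthRate f) : 1 / growthRate g = phi (1 / growthRate f) := by
  obtain ⟨H, hsing, -, h3⟩ := h
  have h3 := h3 hα
  set R := 1 / growthRate f with hR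
  have hR0 : 0 < R := hsing.pos
  have hφR : 0 < phi R := phi_pos hR0
  have hν0 := growthRate_nonneg g hg
  have hle : growthRate g ≤ 1 / phi R := by
    have hc : ContinuousAt (fun t => 1 / phi t) R :=
      continuousAt_const.div (analyticAt_phi R).continuousAt hφR.ne'
    refine ge_of_tendsto (hc.tendsto.mono_left (nhdsWithin_le_nhds (s := Set.Iio R))) ?_
    filter_upwards [Ioo_mem_nhdsLT hR0] with t ht
    exact growthRate_le_of_summable (phi_pos ht.1) (h3 t ⟨ht.1.le, ht.2⟩).1
  have hge : 1 / phi R ≤ growthRate g := by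
    by_contra hlt
    push Not at hlt
    refine hsing.singular ⟨fun t => series g (phi t), fun t ht => ?_, EventuallyEq.rfl⟩
    have hφ : phi t ≤ phi R := by
      rcases ht.2.eq_or_lt with h | h
      · exact h ▸ le_rfl
      · exact (phi_lt_phi ht.1 h (StepSystem.two_mul_pow_le_of_le hα hR0.le le_rfl)).le
    rw [lt_div_iff₀ hφR] at hlt
    obtain ⟨y, hy1, hy2⟩ : ∃ y, phi R < y ∧ y * growthRate g < 1 := by
      rcases hν0.eq_or_lt with h0 | h0
      · exact ⟨phi R + 1, lt_add_one _, by rw [← h0]; simp⟩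
      · obtain ⟨y, h1, h2⟩ := exists_between (show phi R < 1 / growthRate g by
          rw [lt_div_iff₀ h0]; linarith)
        exact ⟨y, h1, by rwa [lt_div_iff₀ h0] at h2⟩
    refine AnalyticAt.fun_comp (StepSystem.analyticAt_series (y := y) ?_
      (summable_of_mul_growthRate_lt_one hg (hφR.trans hy1).le hy2)) (analyticAt_phi t)
    rw [abs_of_nonneg (phi_nonneg ht.1)]
    linarith
  rw [le_antisymm hle hge, one_div_one_div]

/-! ### Paths as words -/

theorem finite_list_length (n : ℕ) (P : List (Fin 3) → Prop) :
    Finite {l : List (Fin 3) // l.length = n ∧ P l} :=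
  ((List.finite_length_eq (Fin 3) n).subset fun _ h => h.1).to_subtype

theorem card_list_cons (P : List (Fin 3) → Prop) (n : ℕ) :
    Nat.card {l : List (Fin 3) // l.length = n + 1 ∧ P l} =
      ∑ i, Nat.card {l : List (Fin 3) // l.length = n ∧ P (i :: l)} := by
  have := fun i : Fin 3 => finite_list_length n fun l => P (i :: l)
  rw [← Nat.card_sigma]
  symm
  refine Nat.card_eq_of_bijective (fun s => ⟨s.1 :: s.2.1, by simp [s.2.2.1], s.2.2.2⟩) ⟨?_, ?_⟩
  · rintro ⟨i, l, hl⟩ ⟨j, m, hm⟩ h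
    simp only [Subtype.mk.injEq, List.cons.injEq] at h
    obtain ⟨rfl, rfl⟩ := h
    rfl
  · rintro ⟨l, hl, hP⟩
    rcases l with _ | ⟨i, l⟩
    · simp at hl
    · exact ⟨⟨i, l, by simpa using hl, hP⟩, rfl⟩

theorem card_list_congr {P Q : List (Fin 3) → Prop} (n : ℕ) (h : ∀ l, P l ↔ Q l) :
    Nat.card {l : List (Fin 3) // l.length = n ∧ P l} =
      Nat.card {l : List (Fin 3) // l.length = n ∧ Q l} := by
  simp only [h]

theorem card_list_false {P : List (Fin 3) → Prop} (n : ℕ) (h : ∀ l, ¬ P l) :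
    Nat.card {l : List (Fin 3) // l.length = n ∧ P l} = 0 := by
  simp [h]

theorem card_list_zero {P : List (Fin 3) → Prop} {Q : Prop} {_ : Decidable Q} (hPQ : P [] ↔ Q) :
    Nat.card {l : List (Fin 3) // l.length = 0 ∧ P l} = if Q then 1 else 0 := by
  split_ifs with h
  · refine Nat.card_eq_one_iff_unique.2 ⟨⟨?_⟩, ⟨⟨[], rfl, hPQ.2 h⟩⟩⟩
    rintro ⟨l, hl, -⟩ ⟨m, hm, -⟩
    rw [List.length_eq_zero_iff] at hl hm
    simp [hl, hm]
  · rw [Nat.card_eq_zero]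
    refine Or.inl ⟨?_⟩
    rintro ⟨l, hl, hP⟩
    rw [List.length_eq_zero_iff] at hl
    exact h (hPQ.1 (hl ▸ hP))

/-- In an alternating word the letter `0`, for the arcs, and the other letters alternate. -/
def Alternating (l : List (Fin 3)) : Prop := l.IsChain fun i j => ¬ (i = 0 ↔ j = 0)

theorem alternating_cons {i : Fin 3} {l : List (Fin 3)} :
    Alternating (i :: l) ↔ (∀ j ∈ l.head?, ¬ (i = 0 ↔ j = 0)) ∧ Alternating l :=
  List.isChain_cons

namespace StepSystem

variable {V : Type*} (S : StepSystem V)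

/-- The neighbour named by a letter. -/
def step (i : Fin 3) : V → V := ![S.a, S.b₁, S.b₂] i

/-- The end of the path from `x` described by a word. -/
def endpoint : V → List (Fin 3) → V
  | x, [] => x
  | x, i :: l => endpoint (S.step i x) l

open Classical in
/-- The indicator function of a set of vertices. -/
def target (O : Set V) (x : V) : ℕ := if x ∈ O then 1 else 0

theorem target_le_one (O : Set V) (x : V) : target O x ≤ 1 := by
  unfold target; split_ifs <;> simp

theorem card_endpoint (O : Set V) (n : ℕ) (x : V) :
    Nat.card {l : List (Fin 3) // l.length = n ∧ S.endpoint x l ∈ O} =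
      S.pathCount (target O) n x := by
  induction n generalizing x with
  | zero => exact card_list_zero Iff.rfl
  | succ n ih =>
    rw [card_list_cons, Fin.sum_univ_three, pathCount]
    simp only [endpoint, ih]
    rfl

theorem card_redPair (O : Set V) (n : ℕ) (x : V) :
    Nat.card {l : List (Fin 3) // l.length = n ∧
      ((∀ i ∈ l.head?, i = 0) ∧ Alternating l) ∧ S.endpoint x l ∈ O} =
        (S.redPair (target O) n x).1 ∧
    Nat.card {l : List (Fin 3) // l.length = n ∧
      ((∀ i ∈ l.head?, i ≠ 0) ∧ Alternating l) ∧ S.endpoint x l ∈ O} =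
        (S.redPair (target O) n x).2 := by
  induction n generalizing x with
  | zero =>
    exact ⟨card_list_zero (by simp [Alternating, endpoint]),
      card_list_zero (by simp [Alternating, endpoint])⟩
  | succ n ih =>
    rw [card_list_cons, card_list_cons, Fin.sum_univ_three, Fin.sum_univ_three, redPair]
    constructor
    · rw [card_list_false (P := fun l => ((∀ i ∈ (1 :: l).head?, i = 0) ∧ _) ∧ _) n (by simp),
        card_list_false (P := fun l => ((∀ i ∈ (2 :: l).head?, i = 0) ∧ _) ∧ _) n (by simp),
        ← (ih _).2]
      simp only [add_zero]
      exact card_list_congr n fun l => by simp [alternating_cons, endpoint, step]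
    · rw [card_list_false (P := fun l => ((∀ i ∈ (0 :: l).head?, i ≠ 0) ∧ _) ∧ _) n (by simp),
        ← (ih _).1, ← (ih _).1, zero_add]
      congr 1
      · exact card_list_congr n fun l => by simp [alternating_cons, endpoint, step]
      · exact card_list_congr n fun l => by simp [alternating_cons, endpoint, step]

theorem card_alternating (O : Set V) (n : ℕ) (x : V) :
    Nat.card {l : List (Fin 3) // l.length = n ∧ Alternating l ∧ S.endpoint x l ∈ O} =
      S.redCount (target O) n x := by
  rcases n with _ | n
  · exact card_list_zero (by simp [Alternating, endpoint])
  · rw [redCount, ← (S.card_redPair O (n + 1) x).1, ← (S.card_redPair O (n + 1) x).2,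
      card_list_cons, card_list_cons, card_list_cons, Fin.sum_univ_three, Fin.sum_univ_three,
      Fin.sum_univ_three, add_assoc]
    simp

end StepSystem

/-! ### Normal forms in the modular group -/

section NormalForms

open Matrix

theorem genA_mul_genA : genA * genA = 1 := by
  rw [genA, ← QuotientGroup.mk_mul, QuotientGroup.eq_one_iff,
    Matrix.SpecialLinearGroup.mem_center_iff]
  refine ⟨-1, by simp, ?_⟩
  ext i j
  fin_cases i <;> fin_cases j <;> simp [ModularGroup.coe_S]

theorem genB_pow_three : genB * genB * genB = 1 := by
  rw [genB, ← QuotientGroup.mk_mul, ← QuotientGroup.mk_mul, QuotientGroup.eq_one_iff,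
    Matrix.SpecialLinearGroup.mem_center_iff]
  refine ⟨-1, by simp, ?_⟩
  ext i j
  fin_cases i <;> fin_cases j <;> simp [ModularGroup.coe_S, ModularGroup.coe_T]

theorem genB_mul_genB : genB * genB = genB⁻¹ := eq_inv_of_mul_eq_one_left genB_pow_three

theorem genB_inv_mul_genB_inv : genB⁻¹ * genB⁻¹ = genB := by
  rw [← _root_.mul_inv_rev, genB_mul_genB, inv_inv]

/-- The Cayley graph of the modular group. -/
def modularSystem : StepSystem Modular where
  a x := x * genA
  b₁ x := x * genB
  b₂ x := x * genB⁻¹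
  a_a x := by rw [mul_assoc, genA_mul_genA, mul_one]
  b_b₁ x := Or.inr ⟨by rw [mul_assoc, genB_mul_genB], by group⟩
  b_b₂ x := Or.inl ⟨by group, by rw [mul_assoc, genB_inv_mul_genB_inv]⟩

/-- The element defined by a word. -/
def listEval (l : List (Fin 3)) : Modular := (l.map gen).prod

theorem listEval_cons (i : Fin 3) (l : List (Fin 3)) : listEval (i :: l) = gen i * listEval l := by
  simp [listEval]

theorem wordEval_eq {n : ℕ} (w : Fin n → Fin 3) : wordEval w = listEval (List.ofFn w) := by
  simp [wordEval, listEval, List.map_ofFn, Function.comp_def]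

theorem modularSystem_step (i : Fin 3) (x : Modular) : modularSystem.step i x = x * gen i := by
  fin_cases i <;> rfl

theorem modularSystem_endpoint (x : Modular) (l : List (Fin 3)) :
    modularSystem.endpoint x l = x * listEval l := by
  induction l generalizing x with
  | nil => simp [StepSystem.endpoint, listEval]
  | cons i l ih => rw [StepSystem.endpoint, ih, modularSystem_step, listEval_cons, mul_assoc]

theorem exists_ofFn (l : List (Fin 3)) : ∃ w : Fin l.length → Fin 3, List.ofFn w = l :=
  ⟨l.get, List.ofFn_get l⟩

theorem card_words (n : ℕ) (P : List (Fin 3) → Prop) :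
    Nat.card {w : Fin n → Fin 3 // P (List.ofFn w)} =
      Nat.card {l : List (Fin 3) // l.length = n ∧ P l} := by
  refine Nat.card_eq_of_bijective (fun w => ⟨List.ofFn w.1, by simp, w.2⟩) ⟨?_, ?_⟩
  · intro w w' h
    exact Subtype.ext (List.ofFn_injective (congrArg Subtype.val h))
  · rintro ⟨l, rfl, hP⟩
    obtain ⟨w, hw⟩ := exists_ofFn l
    exact ⟨⟨w, hw.symm ▸ hP⟩, Subtype.ext hw⟩

theorem circuitCount_eq (Ξ : Subgroup Modular) (n : ℕ) :
    circuitCount Ξ n = modularSystem.pathCount (StepSystem.target Ξ) n 1 := by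
  rw [← StepSystem.card_endpoint, circuitCount]
  simp only [wordEval_eq]
  rw [card_words n fun l => listEval l ∈ Ξ]
  exact card_list_congr n fun l => by rw [modularSystem_endpoint, one_mul]; rfl

/-- Two adjacent letters of the same type cancel or merge by `a² = 1` and `b³ = 1`, which never
lengthens the word. -/
theorem exists_alternating (l : List (Fin 3)) :
    ∃ m, Alternating m ∧ listEval m = listEval l ∧ m.length ≤ l.length := by
  induction l with
  | nil => exact ⟨[], by simp [Alternating], rfl, le_rfl⟩
  | cons i l ih =>
    obtain ⟨m, hm, he, hlen⟩ := ih
    have hcons : ∀ m', Alternating m' → listEval m' = gen i * listEval m →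
        m'.length ≤ m.length + 1 → ∃ m, Alternating m ∧ listEval m = listEval (i :: l) ∧
          m.length ≤ (i :: l).length := fun m' h1 h2 h3 =>
      ⟨m', h1, by rw [h2, he, listEval_cons], by simp; omega⟩
    by_cases halt : Alternating (i :: m)
    · exact hcons _ halt (listEval_cons i m) (by simp)
    rcases m with _ | ⟨j, m⟩
    · simp [Alternating] at halt
    have hij : i = 0 ↔ j = 0 := by
      rw [alternating_cons] at halt
      by_contra h
      exact halt ⟨by simpa using h, hm⟩
    obtain ⟨hj, hm'⟩ := alternating_cons.1 hm
    rw [listEval_cons, ← mul_assoc] at hcons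
    have hdrop : gen i * gen j = 1 → ∃ m, Alternating m ∧ listEval m = listEval (i :: l) ∧
        m.length ≤ (i :: l).length := fun h =>
      hcons m hm' (by rw [h, one_mul]) (by simp; omega)
    have hmerge : ∀ k : Fin 3, (k = 0 ↔ j = 0) → gen i * gen j = gen k →
        ∃ m, Alternating m ∧ listEval m = listEval (i :: l) ∧ m.length ≤ (i :: l).length :=
      fun k hk h => hcons (k :: m) (alternating_cons.2 ⟨by simpa only [hk] using hj, hm'⟩)
        (by rw [listEval_cons, h]) (by simp)
    fin_cases i <;> fin_cases j <;> simp at hij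
    · exact hdrop genA_mul_genA
    · exact hmerge 2 (by decide) genB_mul_genB
    · exact hdrop (mul_inv_cancel genB)
    · exact hdrop (inv_mul_cancel genB)
    · exact hmerge 1 (by decide) genB_inv_mul_genB_inv

/-- The generators as integral matrices. -/
def genSL : Fin 3 → SpecialLinearGroup (Fin 2) ℤ :=
  ![ModularGroup.S, ModularGroup.S * ModularGroup.T, (ModularGroup.S * ModularGroup.T)⁻¹]

theorem mk_genSL (i : Fin 3) : (QuotientGroup.mk (genSL i) : Modular) = gen i := by
  fin_cases i <;> rfl

theorem mk_prod_genSL (l : List (Fin 3)) :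
    (QuotientGroup.mk (l.map genSL).prod : Modular) = listEval l := by
  induction l with
  | nil => rfl
  | cons i l ih =>
    rw [listEval_cons, List.map_cons, List.prod_cons, QuotientGroup.mk_mul, ih, mk_genSL]

/-- The coefficients of the binary quadratic form `16 X² - 2 X Y + 4 Y²` transformed by `g`. -/
def formOf (g : SpecialLinearGroup (Fin 2) ℤ) : ℤ × ℤ × ℤ :=
  (16 * g 0 0 ^ 2 - 2 * (g 0 0 * g 0 1) + 4 * g 0 1 ^ 2,
    16 * (g 0 0 * g 1 0) - (g 0 0 * g 1 1 + g 0 1 * g 1 0) + 4 * (g 0 1 * g 1 1),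
    16 * g 1 0 ^ 2 - 2 * (g 1 0 * g 1 1) + 4 * g 1 1 ^ 2)

/-- The action of the generators on the coefficients of binary quadratic forms. -/
def formStep (i : Fin 3) (F : ℤ × ℤ × ℤ) : ℤ × ℤ × ℤ :=
  ![(F.2.2, -F.2.1, F.1), (F.2.2, -(F.2.1 + F.2.2), F.1 + 2 * F.2.1 + F.2.2),
    (F.1 + 2 * F.2.1 + F.2.2, -(F.1 + F.2.1), F.1)] i

theorem formOf_mul (i : Fin 3) (g : SpecialLinearGroup (Fin 2) ℤ) :
    formOf (genSL i * g) = formStep i (formOf g) := by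
  fin_cases i
  all_goals
    simp [formOf, formStep, genSL, ModularGroup.coe_S, ModularGroup.coe_T,
      Matrix.mul_apply, Fin.sum_univ_two, Matrix.adjugate_fin_two]
    try constructorm* _ ∧ _
    all_goals ring

/-- Representatives differ by a central scalar `r` with `r² = 1`, and the coefficients of the form
are quadratic in the matrix entries. -/
theorem formOf_eq_of_mk_eq {g h : SpecialLinearGroup (Fin 2) ℤ}
    (H : (QuotientGroup.mk g : Modular) = QuotientGroup.mk h) : formOf g = formOf h := by
  rw [QuotientGroup.eq, Matrix.SpecialLinearGroup.mem_center_iff] at H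
  obtain ⟨r, hr, hz⟩ := H
  set z := g⁻¹ * h with hzd
  have hh : h = g * z := by simp [hzd]
  have hr2 : r ^ 2 = 1 := by simpa using hr
  have hent : ∀ i j, h i j = g i j * r := fun i j => by
    rw [hh, Matrix.SpecialLinearGroup.coe_mul, ← hz, Matrix.scalar_apply, Matrix.mul_diagonal]
  simp only [formOf, hent, Prod.mk.injEq]
  refine ⟨?_, ?_, ?_⟩
  · linear_combination -(16 * g 0 0 ^ 2 - 2 * (g 0 0 * g 0 1) + 4 * g 0 1 ^ 2) * hr2
  · linear_combination -(16 * (g 0 0 * g 1 0) - (g 0 0 * g 1 1 + g 0 1 * g 1 0) +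
      4 * (g 0 1 * g 1 1)) * hr2
  · linear_combination -(16 * g 1 0 ^ 2 - 2 * (g 1 0 * g 1 1) + 4 * g 1 1 ^ 2) * hr2

/-- The region of the quadratic forms that are obtained by alternating words with first letter
`i`. -/
def InRegion (F : ℤ × ℤ × ℤ) : Option (Fin 3) → Prop
  | none => F.2.1 < 0 ∧ 0 < 2 * F.2.1 + F.2.2 ∧ 0 < F.1 + 2 * F.2.1
  | some i => ![0 < F.2.1, F.1 + 2 * F.2.1 < 0 ∧ F.1 < F.2.2,
      2 * F.2.1 + F.2.2 < 0 ∧ F.2.2 < F.1] i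

/-- Ping-pong on positive definite forms `A X² + 2x XY + N Y²`. The initial form lies in the region
of the empty word; `a` sends `x < 0` to `x > 0`, while `b` and `b⁻¹` send `2x + N > 0`, `A + 2x > 0`
into their respective regions. Alternation says precisely that the preceding region lies in the
domain required by the next letter. -/
theorem formOf_prod_genSL {l : List (Fin 3)} (hl : Alternating l) :
    let F := formOf (l.map genSL).prod
    0 < F.1 ∧ 0 < F.2.2 ∧ F.2.1 ^ 2 < F.1 * F.2.2 ∧ InRegion F l.head? := by
  induction l with
  | nil => simp [formOf, InRegion]
  | cons i l ih =>
    obtain ⟨hh, hl'⟩ := alternating_cons.1 hl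
    have ih := ih hl'
    simp only [List.map_cons, List.prod_cons, formOf_mul, List.head?_cons]
    generalize formOf (l.map genSL).prod = F at ih
    obtain ⟨A, x, N⟩ := F
    obtain ⟨h1, h2, h3, h4⟩ := ih
    simp only at h1 h2 h3 h4
    -- This is the value of the positive definite form at `(1, 1)`.
    have h5 : 0 < A + 2 * x + N := by nlinarith [sq_nonneg (A + x)]
    have hreg : (i = 0 → x < 0) ∧ (i ≠ 0 → 0 < 2 * x + N ∧ 0 < A + 2 * x) := by
      rcases l with _ | ⟨j, l⟩
      · simp only [List.head?_nil, InRegion] at h4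
        exact ⟨fun _ => h4.1, fun _ => h4.2⟩
      · have hij : ¬ (i = 0 ↔ j = 0) := hh j (by simp)
        simp only [List.head?_cons, InRegion] at h4
        fin_cases j <;> simp at h4 hij
        · exact ⟨fun h => absurd h hij, fun _ => ⟨by omega, by omega⟩⟩
        · exact ⟨fun _ => by omega, fun h => absurd hij h⟩
        · exact ⟨fun _ => by omega, fun h => absurd hij h⟩
    fin_cases i
    · simp [formStep, InRegion] at hreg ⊢
      exact ⟨h2, h1, by linarith, hreg⟩
    · simp [formStep, InRegion] at hreg ⊢
      exact ⟨h2, h5, by nlinarith, by omega, by omega⟩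
    · simp [formStep, InRegion] at hreg ⊢
      exact ⟨h5, h1, by nlinarith, by omega, by omega⟩

theorem head_eq_of_inRegion {F : ℤ × ℤ × ℤ} (h1 : 0 < F.1) (h2 : 0 < F.2.2)
    {i j : Option (Fin 3)} (hi : InRegion F i) (hj : InRegion F j) : i = j := by
  rcases i with _ | i <;> rcases j with _ | j
  · rfl
  · fin_cases j <;> simp [InRegion] at hi hj <;> omega
  · fin_cases i <;> simp [InRegion] at hi hj <;> omega
  · fin_cases i <;> fin_cases j <;> simp [InRegion] at hi hj ⊢ <;> omega

/-- Equal elements give equal forms, and the regions are disjoint, so the first letters agree and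
may be cancelled. -/
theorem listEval_injOn {l m : List (Fin 3)} (hl : Alternating l) (hm : Alternating m)
    (h : listEval l = listEval m) : l = m := by
  induction l generalizing m with
  | nil =>
    have h1 := formOf_prod_genSL hl
    have h2 := formOf_prod_genSL hm
    rw [← mk_prod_genSL, ← mk_prod_genSL] at h
    simp only [formOf_eq_of_mk_eq h] at h1
    have := head_eq_of_inRegion h1.1 h1.2.1 h1.2.2.2 h2.2.2.2
    rcases m with _ | ⟨j, m⟩
    · rfl
    · simp at this
  | cons i l ih =>
    have h1 := formOf_prod_genSL hl
    have h2 := formOf_prod_genSL hm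
    have h' := h
    rw [← mk_prod_genSL, ← mk_prod_genSL] at h'
    simp only [formOf_eq_of_mk_eq h'] at h1
    have := head_eq_of_inRegion h1.1 h1.2.1 h1.2.2.2 h2.2.2.2
    rcases m with _ | ⟨j, m⟩
    · simp at this
    · simp only [List.head?_cons, Option.some.injEq] at this
      subst this
      rw [listEval_cons, listEval_cons, mul_left_cancel_iff] at h
      rw [ih (alternating_cons.1 hl).2 (alternating_cons.1 hm).2 h]

theorem exists_listEval_inv (l : List (Fin 3)) : ∃ m, listEval m = (listEval l)⁻¹ := by
  induction l with
  | nil => exact ⟨[], by simp [listEval]⟩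
  | cons i l ih =>
    obtain ⟨m, hm⟩ := ih
    have hi : ∃ j, gen j = (gen i)⁻¹ := by
      fin_cases i
      · exact ⟨0, eq_inv_of_mul_eq_one_left genA_mul_genA⟩
      · exact ⟨2, rfl⟩
      · exact ⟨1, (inv_inv genB).symm⟩
    obtain ⟨j, hj⟩ := hi
    refine ⟨m ++ [j], ?_⟩
    rw [listEval_cons, _root_.mul_inv_rev, ← hm, ← hj]
    simp [listEval]

theorem listEval_surjective (γ : Modular) : ∃ l, listEval l = γ := by
  obtain ⟨g, rfl⟩ := QuotientGroup.mk_surjective γ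
  have hg : g ∈ Subgroup.closure {ModularGroup.S, ModularGroup.T} := by
    rw [SpecialLinearGroup.SL2Z_generators]; trivial
  induction hg using Subgroup.closure_induction with
  | mem x hx =>
    rcases hx with rfl | rfl
    · exact ⟨[0], by simp [listEval, gen, genA]⟩
    · refine ⟨[0, 1], ?_⟩
      have : listEval [0, 1] = genA * (genA * QuotientGroup.mk ModularGroup.T) := by
        simp [listEval, gen, genA, genB]
      rw [this, ← mul_assoc, genA_mul_genA, one_mul]
  | one => exact ⟨[], rfl⟩
  | mul x y _ _ hx hy =>
    obtain ⟨l, hl⟩ := hx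
    obtain ⟨m, hm⟩ := hy
    exact ⟨l ++ m, by rw [QuotientGroup.mk_mul, ← hl, ← hm]; simp [listEval]⟩
  | inv x _ hx =>
    obtain ⟨l, hl⟩ := hx
    obtain ⟨m, hm⟩ := exists_listEval_inv l
    exact ⟨m, by rw [hm, hl, QuotientGroup.mk_inv]⟩

/-- Any competing word reduces to an alternating word of no greater length, which by uniqueness of
normal forms is `l`. -/
theorem wordLength_listEval {l : List (Fin 3)} (hl : Alternating l) :
    wordLength (listEval l) = l.length := by
  refine le_antisymm (Nat.sInf_le ?_) (le_csInf ?_ ?_)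
  · obtain ⟨w, hw⟩ := exists_ofFn l
    exact ⟨w, by rw [wordEval_eq, hw]⟩
  · obtain ⟨w, hw⟩ := exists_ofFn l
    exact ⟨_, w, by rw [wordEval_eq, hw]⟩
  · rintro n ⟨w, hw⟩
    obtain ⟨m, hm, he, hlen⟩ := exists_alternating (List.ofFn w)
    rw [← wordEval_eq, hw] at he
    rw [listEval_injOn hl hm he.symm]
    simpa using hlen

/-- Normal forms turn elements of `Ξ` of length `n` into reduced paths of length `n` in the Cayley
graph from `1` to the set `Ξ`. -/
theorem cogrowthCount_eq (Ξ : Subgroup Modular) (n : ℕ) :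
    cogrowthCount Ξ n = modularSystem.redCount (StepSystem.target Ξ) n 1 := by
  rw [← StepSystem.card_alternating, cogrowthCount]
  symm
  refine Nat.card_eq_of_bijective (fun l => ⟨listEval l.1, ?_, ?_⟩) ⟨?_, ?_⟩
  · have := l.2.2.2
    rwa [modularSystem_endpoint, one_mul] at this
  · rw [wordLength_listEval l.2.2.1, l.2.1]
  · intro l m h
    exact Subtype.ext (listEval_injOn l.2.2.1 m.2.2.1 (congrArg Subtype.val h))
  · rintro ⟨γ, hγ, hn⟩
    obtain ⟨l, rfl⟩ := listEval_surjective γ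
    obtain ⟨m, hm, he, -⟩ := exists_alternating l
    refine ⟨⟨m, ?_, hm, ?_⟩, Subtype.ext he⟩
    · rw [← wordLength_listEval hm, he, hn]
    · rw [modularSystem_endpoint, one_mul, he]
      exact hγ

/-! ### Random walk, comparison of series and word growth for the modular group -/

theorem hitProb_eq (Ξ : Subgroup Modular) (n : ℕ) (x : Modular) :
    hitProb Ξ n x = modularSystem.pathCount (StepSystem.target Ξ) n x / 3 ^ n := by
  induction n generalizing x with
  | zero =>
    by_cases hx : x ∈ Ξ <;> simp [hitProb, StepSystem.pathCount, StepSystem.target, hx]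
  | succ n ih =>
    rw [hitProb, Fin.sum_univ_three, ih, ih, ih, StepSystem.pathCount]
    have h0 : x * gen 0 = modularSystem.a x := rfl
    have h1 : x * gen 1 = modularSystem.b₁ x := rfl
    have h2 : x * gen 2 = modularSystem.b₂ x := rfl
    rw [h0, h1, h2]
    push_cast
    ring

theorem circuitCount_le (Ξ : Subgroup Modular) (n : ℕ) : circuitCount Ξ n ≤ 3 ^ n := by
  rw [circuitCount_eq]
  exact StepSystem.pathCount_le _ _ (StepSystem.target_le_one _) n 1

theorem growthRate_circuitCount (Ξ : Subgroup Modular) :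
    growthRate (circuitCount Ξ) = 3 * walkSpectralRadius Ξ := by
  have h : (fun n : ℕ => hitProb Ξ n 1 ^ (1 / (n : ℝ))) =ᶠ[atTop]
      fun n : ℕ => (circuitCount Ξ n : ℝ) ^ (1 / (n : ℝ)) / 3 := by
    filter_upwards [eventually_ne_atTop 0] with n hn
    rw [hitProb_eq, ← circuitCount_eq, Real.div_rpow (by positivity) (by positivity)]
    congr 1
    rw [one_div, Real.pow_rpow_inv_natCast (by norm_num) hn]
  have hmono : Monotone fun y : ℝ => y / 3 := fun y z hyz => by dsimp only; linarith
  have := hmono.map_limsup_of_continuousAt (a := fun n : ℕ => (circuitCount Ξ n : ℝ) ^ (1 / (n : ℝ))) (F := atTop) (by fun_prop)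
    (isBoundedUnder_root (circuitCount_le Ξ)) (isCoboundedUnder_root _)
  have h2 : growthRate (circuitCount Ξ) / 3 = walkSpectralRadius Ξ := by
    rw [walkSpectralRadius, limsup_congr h]
    exact this
  rw [← h2]
  ring

theorem equivPhi_modular (Ξ : Subgroup Modular) (hα : 1 < growthRate (cogrowthCount Ξ)) :
    EquivPhi (cogrowthCount Ξ) (circuitCount Ξ) := by
  rw [funext (cogrowthCount_eq Ξ)] at hα ⊢
  rw [funext (circuitCount_eq Ξ)]
  exact modularSystem.equivPhi (StepSystem.target_le_one _)
    (by simp [StepSystem.target, one_mem]) hα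

/-- Each arc offers one choice and each triangle edge two, so the counts double every two steps; the
stray factors `√2` absorb the parity of `n`. -/
theorem redPair_const_one {V : Type*} (S : StepSystem V) {δ : V → ℕ} (hδ : ∀ x, δ x = 1) (n : ℕ)
    (x : V) : √2 ^ n ≤ √2 * ((S.redPair δ n x).1 : ℝ) ∧ ((S.redPair δ n x).1 : ℝ) ≤ √2 ^ n ∧
      √2 ^ n ≤ ((S.redPair δ n x).2 : ℝ) ∧ ((S.redPair δ n x).2 : ℝ) ≤ √2 * √2 ^ n := by
  have h1 : (1 : ℝ) ≤ √2 := Real.one_le_sqrt.2 (by norm_num)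
  have h2 : √2 * √2 = (2 : ℝ) := Real.mul_self_sqrt (by norm_num)
  induction n generalizing x with
  | zero => simp [StepSystem.redPair, hδ, h1]
  | succ n ih =>
    obtain ⟨-, -, ha1, ha2⟩ := ih (S.a x)
    obtain ⟨hb1, hb2, -, -⟩ := ih (S.b₁ x)
    obtain ⟨hc1, hc2, -, -⟩ := ih (S.b₂ x)
    simp only [StepSystem.redPair, pow_succ]
    push_cast
    refine ⟨by nlinarith, by nlinarith, by nlinarith, ?_⟩
    calc _ ≤ √2 ^ n + √2 ^ n := add_le_add hb2 hc2
      _ = √2 * (√2 ^ n * √2) := by linear_combination -(√2 ^ n) * h2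

theorem growthRate_cogrowthCount_top : growthRate (cogrowthCount ⊤) = √2 := by
  have h1 : (1 : ℝ) ≤ √2 := Real.one_le_sqrt.2 (by norm_num)
  have hδ : ∀ x : Modular, StepSystem.target ((⊤ : Subgroup Modular) : Set Modular) x = 1 :=
    fun x => by simp [StepSystem.target]
  rw [funext (cogrowthCount_eq ⊤)]
  have hb := fun n => redPair_const_one modularSystem hδ n 1
  refine le_antisymm (growthRate_le_of_bound (C := 1 + √2) (by positivity) fun n => ?_)
    (le_growthRate_of_bound (fun n => StepSystem.redCount_le _ _ (StepSystem.target_le_one _) n 1)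
      (by positivity) fun n => ?_)
  · rcases n with _ | n
    · rw [StepSystem.redCount, hδ]
      simp
    · rw [StepSystem.redCount, add_mul, one_mul]
      push_cast
      exact add_le_add (hb _).2.1 (hb _).2.2.2
  · rcases n with _ | n
    · rw [StepSystem.redCount, hδ]
      simp
    · rw [StepSystem.redCount]
      push_cast
      exact (hb _).2.2.1.trans (le_add_of_nonneg_left (by positivity))

end NormalForms

/-! ### Complexes of triangles and arcs as step systems -/

namespace TriangleComplex

open Classical

variable {V : Type*} (X : TriangleComplex V)

/-- The triangle at a vertex. -/
def triangle (v : V) : Finset V := (X.triangle_at v).choose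

theorem triangle_mem (v : V) : X.triangle v ∈ X.triangles := (X.triangle_at v).choose_spec.1.1

theorem self_mem_triangle (v : V) : v ∈ X.triangle v := (X.triangle_at v).choose_spec.1.2

theorem eq_triangle {v : V} {T : Finset V} (hT : T ∈ X.triangles) (hv : v ∈ T) :
    T = X.triangle v := (X.triangle_at v).unique ⟨hT, hv⟩ ⟨X.triangle_mem v, X.self_mem_triangle v⟩

theorem triangle_eq_of_mem {v w : V} (hw : w ∈ X.triangle v) : X.triangle w = X.triangle v :=
  (X.eq_triangle (X.triangle_mem v) hw).symm

/-- The other end of the arc at a vertex. -/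
def arc (v : V) : V := (X.edge_at v).choose

theorem adj_arc (v : V) : X.graph.Adj v (X.arc v) := (X.edge_at v).choose_spec.1.1

theorem not_mem_of_arc (v : V) : ∀ T ∈ X.triangles, ¬ (v ∈ T ∧ X.arc v ∈ T) :=
  (X.edge_at v).choose_spec.1.2

theorem eq_arc {v w : V} (h : X.graph.Adj v w) (hT : ∀ T ∈ X.triangles, ¬ (v ∈ T ∧ w ∈ T)) :
    w = X.arc v :=
  (X.edge_at v).unique ⟨h, hT⟩ ⟨X.adj_arc v, X.not_mem_of_arc v⟩

theorem arc_arc (v : V) : X.arc (X.arc v) = v :=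
  (X.eq_arc (X.adj_arc v).symm fun T hT h => X.not_mem_of_arc v T hT h.symm).symm

theorem exists_others (v : V) :
    ∃ q : V × V, q.1 ≠ q.2 ∧ (X.triangle v).erase v = {q.1, q.2} := by
  have h : ((X.triangle v).erase v).card = 2 := by
    rw [Finset.card_erase_of_mem (X.self_mem_triangle v),
      (X.isClique _ (X.triangle_mem v)).card_eq]
  obtain ⟨x, y, hxy, he⟩ := Finset.card_eq_two.1 h
  exact ⟨(x, y), hxy, he⟩

/-- The other two vertices of the triangle at a vertex. -/
def others (v : V) : V × V := (X.exists_others v).choose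

theorem others_ne (v : V) : (X.others v).1 ≠ (X.others v).2 := (X.exists_others v).choose_spec.1

theorem erase_triangle (v : V) :
    (X.triangle v).erase v = {(X.others v).1, (X.others v).2} := (X.exists_others v).choose_spec.2

theorem mem_others_iff {v w : V} :
    w = (X.others v).1 ∨ w = (X.others v).2 ↔ w ≠ v ∧ w ∈ X.triangle v := by
  rw [← Finset.mem_erase, erase_triangle]
  simp

theorem others_of_mem {v w x : V} (hw : w ∈ X.triangle v) (hvw : w ≠ v) (hx : x ∈ X.triangle v)
    (hxv : x ≠ v) (hxw : x ≠ w) :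
    ((X.others w).1 = v ∧ (X.others w).2 = x) ∨ ((X.others w).1 = x ∧ (X.others w).2 = v) := by
  have hT := X.triangle_eq_of_mem hw
  have h1 := X.mem_others_iff.2 (⟨hvw.symm, by rw [hT]; exact X.self_mem_triangle v⟩ :
    v ≠ w ∧ v ∈ X.triangle w)
  have h2 := X.mem_others_iff.2 (⟨hxw, by rw [hT]; exact hx⟩ : x ≠ w ∧ x ∈ X.triangle w)
  rcases h1 with h1 | h1 <;> rcases h2 with h2 | h2
  · exact absurd (h2.trans h1.symm) hxv
  · exact Or.inl ⟨h1.symm, h2.symm⟩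
  · exact Or.inr ⟨h2.symm, h1.symm⟩
  · exact absurd (h2.trans h1.symm) hxv

/-- The step system of a complex of triangles and arcs. -/
def system : StepSystem V where
  a := X.arc
  b₁ v := (X.others v).1
  b₂ v := (X.others v).2
  a_a := X.arc_arc
  b_b₁ v := by
    have h1 := X.mem_others_iff.1 (Or.inl rfl : (X.others v).1 = (X.others v).1 ∨ _)
    have h2 := X.mem_others_iff.1 (Or.inr rfl : _ ∨ (X.others v).2 = (X.others v).2)
    exact X.others_of_mem h1.2 h1.1 h2.2 h2.1 (X.others_ne v).symm
  b_b₂ v := by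
    have h1 := X.mem_others_iff.1 (Or.inl rfl : (X.others v).1 = (X.others v).1 ∨ _)
    have h2 := X.mem_others_iff.1 (Or.inr rfl : _ ∨ (X.others v).2 = (X.others v).2)
    exact X.others_of_mem h2.2 h2.1 h1.2 h1.1 (X.others_ne v)

theorem step_zero (v : V) : X.system.step 0 v = X.arc v := rfl

theorem step_ne_zero_mem {i : Fin 3} (hi : i ≠ 0) (v : V) :
    X.system.step i v ≠ v ∧ X.system.step i v ∈ X.triangle v := by
  rw [← X.mem_others_iff]
  fin_cases i
  · exact absurd rfl hi
  · exact Or.inl rfl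
  · exact Or.inr rfl

theorem adj_of_mem_triangle {v w : V} (h : w ∈ X.triangle v) (hne : w ≠ v) : X.graph.Adj v w :=
  (X.isClique _ (X.triangle_mem v)).isClique (X.self_mem_triangle v) h hne.symm

theorem adj_step (i : Fin 3) (v : V) : X.graph.Adj v (X.system.step i v) := by
  by_cases hi : i = 0
  · subst hi
    exact X.adj_arc v
  · exact X.adj_of_mem_triangle (X.step_ne_zero_mem hi v).2 (X.step_ne_zero_mem hi v).1

theorem exists_step {v w : V} (h : X.graph.Adj v w) : ∃ i, X.system.step i v = w := by
  by_cases hT : ∃ T ∈ X.triangles, v ∈ T ∧ w ∈ T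
  · obtain ⟨T, hT, hv, hw⟩ := hT
    rw [X.eq_triangle hT hv] at hw
    rcases X.mem_others_iff.2 ⟨h.ne', hw⟩ with h | h
    · exact ⟨1, h.symm⟩
    · exact ⟨2, h.symm⟩
  · push Not at hT
    exact ⟨0, (X.eq_arc h fun T h1 h2 => hT T h1 h2.1 h2.2).symm⟩

theorem arc_not_mem_triangle (v : V) : X.arc v ∉ X.triangle v := fun h =>
  X.not_mem_of_arc v _ (X.triangle_mem v) ⟨X.self_mem_triangle v, h⟩

theorem step_injective (v : V) : Function.Injective fun i => X.system.step i v := by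
  have h0 : ∀ {i : Fin 3}, i ≠ 0 → X.system.step i v ≠ X.system.step 0 v := fun hi h =>
    X.arc_not_mem_triangle v (by rw [← X.step_zero, ← h]; exact (X.step_ne_zero_mem hi v).2)
  intro i j h
  fin_cases i <;> fin_cases j <;> simp only at h ⊢
  · exact absurd h.symm (h0 (by decide))
  · exact absurd h.symm (h0 (by decide))
  · exact absurd h (h0 (by decide))
  · exact absurd h (X.others_ne v)
  · exact absurd h (h0 (by decide))
  · exact absurd h.symm (X.others_ne v)

/-- The letter that describes an oriented edge. -/
def letter (d : X.graph.Dart) : Fin 3 := (X.exists_step d.adj).choose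

theorem step_letter (d : X.graph.Dart) : X.system.step (X.letter d) d.fst = d.snd :=
  (X.exists_step d.adj).choose_spec

theorem letter_eq {d : X.graph.Dart} {i : Fin 3} (h : X.system.step i d.fst = d.snd) :
    X.letter d = i := X.step_injective d.fst ((X.step_letter d).trans h.symm)

theorem letter_eq_zero_iff (d : X.graph.Dart) :
    X.letter d = 0 ↔ d.snd ∉ X.triangle d.fst := by
  constructor
  · intro h
    have := X.step_letter d
    rw [h] at this
    rw [← this]
    exact X.arc_not_mem_triangle _
  · intro h
    by_contra h0
    exact h (X.step_letter d ▸ (X.step_ne_zero_mem h0 d.fst).2)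

/-- The word that describes a walk. -/
def code {u v : V} (p : X.graph.Walk u v) : List (Fin 3) := p.darts.map X.letter

theorem length_code {u v : V} (p : X.graph.Walk u v) : (X.code p).length = p.length := by
  simp [code]

theorem endpoint_code {u v : V} (p : X.graph.Walk u v) : X.system.endpoint u (X.code p) = v := by
  induction p with
  | nil => rfl
  | cons h p ih =>
    rw [code, SimpleGraph.Walk.darts_cons, List.map_cons, StepSystem.endpoint, X.step_letter]
    exact ih

theorem code_injective {u v : V} {p q : X.graph.Walk u v} (h : X.code p = X.code q) : p = q := by
  induction p with
  | nil =>
    cases q with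
    | nil => rfl
    | cons h' q => simp [code] at h
  | @cons u w v hw p ih =>
    cases q with
    | nil => simp [code] at h
    | @cons _ w' _ hw' q =>
      simp only [code, SimpleGraph.Walk.darts_cons, List.map_cons, List.cons.injEq] at h
      have h1 := X.step_letter ⟨(u, w), hw⟩
      have h2 := X.step_letter ⟨(u, w'), hw'⟩
      rw [h.1] at h1
      obtain rfl : w = w' := h1.symm.trans h2
      rw [ih h.2]

theorem exists_code (l : List (Fin 3)) {u v : V} (h : X.system.endpoint u l = v) :
    ∃ p : X.graph.Walk u v, X.code p = l := by
  induction l generalizing u with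
  | nil =>
    obtain rfl : u = v := h
    exact ⟨.nil, rfl⟩
  | cons i l ih =>
    obtain ⟨p, hp⟩ := ih h
    refine ⟨.cons (X.adj_step i u) p, ?_⟩
    rw [code, SimpleGraph.Walk.darts_cons, List.map_cons]
    congr 1
    exact X.letter_eq rfl

/-- An edge and its inverse have the same type. Conversely, two successive arcs must backtrack, as a
vertex has only one arc, and two successive triangle edges share a vertex, hence lie in the same
triangle. So reduced means that the types alternate. -/
theorem reduced_pair_iff {d e : X.graph.Dart} (h : d.snd = e.fst) :
    (e ≠ d.symm ∧ ¬ ∃ T ∈ X.triangles, d.fst ∈ T ∧ d.snd ∈ T ∧ e.fst ∈ T ∧ e.snd ∈ T) ↔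
      ¬ (X.letter d = 0 ↔ X.letter e = 0) := by
  have hd := X.letter_eq_zero_iff d
  have he := X.letter_eq_zero_iff e
  have hsymm : e = d.symm ↔ e.snd = d.fst := by
    constructor
    · rintro rfl; rfl
    · intro h'
      exact SimpleGraph.Dart.ext _ _ (Prod.ext h.symm h')
  have htri : (∃ T ∈ X.triangles, d.fst ∈ T ∧ d.snd ∈ T ∧ e.fst ∈ T ∧ e.snd ∈ T) ↔
      X.letter d ≠ 0 ∧ X.letter e ≠ 0 := by
    rw [Ne, hd, Ne, he, not_not, not_not]
    constructor
    · rintro ⟨T, hT, h1, h2, h3, h4⟩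
      rw [← X.eq_triangle hT h1, ← X.eq_triangle hT h3]
      exact ⟨h2, h4⟩
    · rintro ⟨h1, h2⟩
      have hT := X.triangle_eq_of_mem h1
      rw [← h, hT] at h2
      exact ⟨_, X.triangle_mem d.fst, X.self_mem_triangle _, h1, h ▸ h1, h2⟩
  rw [htri, Ne, hsymm]
  have hback : e.snd = d.fst → (X.letter d = 0 ↔ X.letter e = 0) := by
    intro hb
    rw [hd, he, hb, ← h, not_iff_not]
    constructor
    · intro hm
      rw [X.triangle_eq_of_mem hm]
      exact X.self_mem_triangle _
    · intro hm
      rw [X.triangle_eq_of_mem hm]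
      exact X.self_mem_triangle _
  have harc : X.letter d = 0 → X.letter e = 0 → e.snd = d.fst := by
    intro h1 h2
    rw [← X.step_letter e, h2, ← h, ← X.step_letter d, h1]
    exact X.arc_arc _
  tauto

theorem alternating_code_iff {u v : V} (p : X.graph.Walk u v) :
    Alternating (X.code p) ↔ X.IsReduced p := by
  rw [Alternating, code, List.isChain_map, IsReduced]
  have hadj := p.isChain_dartAdj_darts
  simp only [List.isChain_iff_getElem] at hadj ⊢
  exact forall₂_congr fun i hi => (X.reduced_pair_iff (hadj i hi)).symm

theorem card_walks (o : V) (n : ℕ) (P : List (Fin 3) → Prop) :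
    Nat.card {p : X.graph.Walk o o // p.length = n ∧ P (X.code p)} =
      Nat.card {l : List (Fin 3) // l.length = n ∧ P l ∧ X.system.endpoint o l ∈ ({o} : Set V)} := by
  refine Nat.card_eq_of_bijective
    (fun p => ⟨X.code p.1, by rw [X.length_code, p.2.1], p.2.2, X.endpoint_code p.1⟩) ⟨?_, ?_⟩
  · intro p q h
    exact Subtype.ext (X.code_injective (congrArg Subtype.val h))
  · rintro ⟨l, hl, hP, ho⟩
    obtain ⟨p, rfl⟩ := X.exists_code l ho
    exact ⟨⟨p, by rw [← X.length_code, hl], hP⟩, rfl⟩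

theorem reducedCount_eq (o : V) (n : ℕ) :
    X.reducedCount o n = X.system.redCount (StepSystem.target {o}) n o := by
  rw [← StepSystem.card_alternating, ← X.card_walks, reducedCount]
  simp only [X.alternating_code_iff]

theorem circuitCount_eq (o : V) (n : ℕ) :
    X.circuitCount o n = X.system.pathCount (StepSystem.target {o}) n o := by
  rw [← StepSystem.card_endpoint, circuitCount]
  have := X.card_walks o n fun _ => True
  simpa using this

theorem equivPhi (o : V) (hα : 1 < growthRate (X.reducedCount o)) :
    EquivPhi (X.reducedCount o) (X.circuitCount o) := by
  rw [funext (X.reducedCount_eq o)] at hα ⊢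
  rw [funext (X.circuitCount_eq o)]
  exact X.system.equivPhi (StepSystem.target_le_one _) (by simp [StepSystem.target]) hα

end TriangleComplex

end ModularCogrowth

end

theorem mainTheorem10 :
    -- the theorem, for complexes of triangles and arcs
    (∀ {V : Type*} (X : ModularCogrowth.TriangleComplex V) (o : V),
      1 < ModularCogrowth.growthRate (X.reducedCount o) →
        ModularCogrowth.EquivPhi (X.reducedCount o) (X.circuitCount o)) ∧
    -- the theorem, for torsion-free subgroups of the modular group
    (∀ Ξ : Subgroup ModularCogrowth.Modular, (∀ γ ∈ Ξ, IsOfFinOrder γ → γ = 1) →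
      1 < ModularCogrowth.growthRate (ModularCogrowth.cogrowthCount Ξ) →
        ModularCogrowth.EquivPhi (ModularCogrowth.cogrowthCount Ξ)
          (ModularCogrowth.circuitCount Ξ)) ∧
    -- the word growth of the modular group
    ModularCogrowth.growthRate (ModularCogrowth.cogrowthCount ⊤) = √2 ∧
    -- the corollary
    (∀ (Ξ : Subgroup ModularCogrowth.Modular), (∀ γ ∈ Ξ, IsOfFinOrder γ → γ = 1) →
      ∀ α ν ρ : ℝ,
        α = ModularCogrowth.growthRate (ModularCogrowth.cogrowthCount Ξ) →
        ν = ModularCogrowth.growthRate (ModularCogrowth.circuitCount Ξ) →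
        ρ = ModularCogrowth.growthRate (ModularCogrowth.cogrowthCount ⊤) →
        ν = 3 * ModularCogrowth.walkSpectralRadius Ξ ∧
        (α ∈ Set.Icc (√ρ) ρ →
          1 / ν = ModularCogrowth.phi (1 / α) ∧
          ν = 1 / 2 * √(8 * α⁻¹ ^ 2 + 13 + 4 * α ^ 2) + 1 / 2)) := by
  refine ⟨fun X o hα => X.equivPhi o hα, fun Ξ _ hα => ModularCogrowth.equivPhi_modular Ξ hα,
    ModularCogrowth.growthRate_cogrowthCount_top, ?_⟩
  rintro Ξ - α ν ρ rfl rfl rfl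
  refine ⟨ModularCogrowth.growthRate_circuitCount Ξ, fun hα => ?_⟩
  rw [ModularCogrowth.growthRate_cogrowthCount_top] at hα
  -- Since `ρ = √2`, the lower end `√ρ` of the interval is `2^(1/4)`: it exceeds `1` and is exactly
  -- the threshold of the convergent range.
  have h1 : 1 < √(√2) := Real.lt_sqrt_of_sq_lt (by
    rw [one_pow]; exact Real.lt_sqrt_of_sq_lt (by norm_num))
  have hα1 := h1.trans_le hα.1
  have hν := (ModularCogrowth.equivPhi_modular Ξ hα1).one_div_growthRate
    (ModularCogrowth.circuitCount_le Ξ) hα.1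
  refine ⟨hν, ?_⟩
  have h2 := ModularCogrowth.one_div_phi (one_div_pos.2 (zero_lt_one.trans hα1))
  rw [← hν, one_div_one_div] at h2
  rw [h2]
  simp only [one_div, inv_inv]
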